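/- A 2-player game arena $G=(S,\{S_1,S_2\},s_{\mathsf{init}},\Sigma,\Delta)$ consists of a nonempty finite set $S$ of states, partitioned into the states $S_1$ of Player 1 and $S_2$ of Player 2 (one of the two sets may be empty), an initial state $s_{\mathsf{init}}\in S$, a nonempty finite set $\Sigma$ of actions, and a transition function $\Delta:S\times\Sigma\to S$. A play is an infinite sequence $\rho=s_0s_1s_2\cdots$ with $s_0=s_{\mathsf{init}}$ such that for every $j$ there is $\sigma\in\Sigma$ with $s_{j+1}=\Delta(s_j,\sigma)$. A strategy $\lambda_i$ of Player $i$ maps each finite prefix of a play whose last state is in $S_i$ to an action; $\mathsf{outcome}_i(\lambda_i)$ is the set of plays $\rho$ such that $s_{j+1}=\Delta(s_j,\lambda_i(s_0\cdots s_j))$ whenever $s_j\in S_i$, and $\mathsf{outcome}(\lambda_1,\lambda_2)$ is the unique play in $\mathsf{outcome}_1(\lambda_1)\cap\mathsf{outcome}_2(\lambda_2)$. Let $\inf(\rho)$ be the set of states that occur infinitely often in $\rho$. For $T\subseteq S$, the Büchi objective of $T$ is $\{\rho\in S^\omega : \inf(\rho)\cap T\neq\emptyset\}$ and the co-Büchi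 objective of $T$ is $\{\rho\in S^\omega : \inf(\rho)\subseteq T\}$. A doomsday equilibrium for objectives $\varphi_1,\varphi_2\subseteq S^\omega$ is a pair of strategies $(\lambda_1,\lambda_2)$ such that 1. $\mathsf{outcome}(\lambda_1,\lambda_2)\in\varphi_1\cap\varphi_2$, and 2. for each $i\in\{1,2\}$ and each $\rho\in\mathsf{outcome}_i(\lambda_i)$, if $\rho\notin\varphi_i$ then $\rho\notin\varphi_1$ and $\rho\notin\varphi_2$. **Lemma.** Each of the following two decision problems is PTIME-hard: given an (explicitly encoded) 2-player game arena and sets $T_1,T_2\subseteq S$, decide whether there is a doomsday equilibrium when, for $i=1,2$, the objective of Player $i$ is (a) the Büchi objective of $T_i$; (b) the co-Büchi objective of $T_i$. Here a problem is PTIME-hard if every language over a finite alphabet that is decidable in deterministic polynomial time reduces to it by a many-one reduction computable in logarithmic space. -/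

import Mathlib

namespace Doomsday

/-! ### Game arenas with perfect information -/

/-- An `n`-player game arena with states `S` and actions `Act`; `owner` gives the partition of the
states among the players. Finiteness and non-emptiness of `S` and `Act` are imposed where
arenas serve as inputs of a decision problem, see `Instance2`. -/
structure Arena (n : ℕ) (S Act : Type) where
  owner : S → Fin n
  init : S
  trans : S → Act → S

variable {n : ℕ} {S Act : Type}

/-- The finite prefix `ρ(0..j) = ρ(0) ρ(1) … ρ(j)` of an infinite sequence. -/
def pref (ρ : ℕ → S) (j : ℕ) : List S := (List.range (j + 1)).map ρ

namespace Arena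

/-- Plays: infinite sequences of states that start in the initial state and follow transitions. -/
def Plays (G : Arena n S Act) : Set (ℕ → S) :=
  {ρ | ρ 0 = G.init ∧ ∀ j, ∃ a, ρ (j + 1) = G.trans (ρ j) a}

/-- Finite prefixes of plays. -/
def PrefPlays (G : Arena n S Act) : Set (List S) :=
  {π | ∃ ρ ∈ G.Plays, ∃ j, π = pref ρ j}

/-- Prefixes of plays whose last state belongs to Player `i`. -/
def PrefPlaysOf (G : Arena n S Act) (i : Fin n) : Set (List S) :=
  {π | π ∈ G.PrefPlays ∧ ∃ s, π.getLast? = some s ∧ G.owner s = i}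

/-- A strategy of Player `i` maps the prefixes of plays that belong to Player `i` to actions. -/
abbrev Strategy (G : Arena n S Act) (i : Fin n) : Type := G.PrefPlaysOf i → Act

/-- A strategy profile: one strategy for each player. -/
abbrev Profile (G : Arena n S Act) : Type := ∀ i : Fin n, G.Strategy i

/-- The plays that are consistent with a strategy of Player `i`. -/
def outcome (G : Arena n S Act) (i : Fin n) (σ : G.Strategy i) : Set (ℕ → S) :=
  {ρ | ρ ∈ G.Plays ∧
    ∀ (j : ℕ) (h : pref ρ j ∈ G.PrefPlaysOf i), ρ (j + 1) = G.trans (ρ j) (σ ⟨pref ρ j, h⟩)}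

/-- `ρ` is the outcome of the strategy profile: the play that is consistent with the strategy of
every player. There is exactly one such play if there is an action,
see `existsUnique_isOutcome`. -/
def IsOutcome (G : Arena n S Act) (Λ : G.Profile) (ρ : ℕ → S) : Prop :=
  ρ ∈ G.Plays ∧
    ∀ (j : ℕ) (i : Fin n) (h : pref ρ j ∈ G.PrefPlaysOf i),
      ρ (j + 1) = G.trans (ρ j) (Λ i ⟨pref ρ j, h⟩)

/-- Doomsday equilibrium for the objectives `φ`: the outcome of the profile satisfies all
objectives, and every play that is consistent with the strategy of Player `i` and violates the
objective of Player `i` violates the objectives of all players. -/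
def IsDoomsdayEquilibrium (G : Arena n S Act) (φ : Fin n → Set (ℕ → S)) (Λ : G.Profile) : Prop :=
  (∃ ρ, G.IsOutcome Λ ρ ∧ ∀ i, ρ ∈ φ i) ∧
    ∀ i, ∀ ρ ∈ G.outcome i (Λ i), ρ ∉ φ i → ∀ j, ρ ∉ φ j

/-- There is a doomsday equilibrium for the objectives `φ`. -/
def HasDoomsdayEquilibrium (G : Arena n S Act) (φ : Fin n → Set (ℕ → S)) : Prop :=
  ∃ Λ : G.Profile, G.IsDoomsdayEquilibrium φ Λ

/-! The outcome of a strategy profile exists and is unique. -/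

theorem pref_succ (ρ : ℕ → S) (j : ℕ) : pref ρ (j + 1) = pref ρ j ++ [ρ (j + 1)] := by
  simp [pref, List.range_succ]

theorem getLast?_pref (ρ : ℕ → S) (j : ℕ) : (pref ρ j).getLast? = some (ρ j) := by
  simp [pref, List.range_succ]

theorem pref_mem_prefPlaysOf {G : Arena n S Act} {ρ : ℕ → S} (hρ : ρ ∈ G.Plays) (j : ℕ) :
    pref ρ j ∈ G.PrefPlaysOf (G.owner (ρ j)) :=
  ⟨⟨ρ, hρ, j, rfl⟩, ρ j, getLast?_pref ρ j, rfl⟩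

theorem existsUnique_isOutcome [Nonempty Act] (G : Arena n S Act) (Λ : G.Profile) :
    ∃! ρ, G.IsOutcome Λ ρ := by
  classical
  let act : List S → S → Act := fun π s =>
    if h : π ∈ G.PrefPlaysOf (G.owner s) then Λ (G.owner s) ⟨π, h⟩ else Classical.arbitrary Act
  let st : ℕ → List S × S := fun j =>
    Nat.rec ([G.init], G.init)
      (fun _ p => (p.1 ++ [G.trans p.2 (act p.1 p.2)], G.trans p.2 (act p.1 p.2))) j
  let ρ : ℕ → S := fun j => (st j).2
  have hst : ∀ j, (st j).1 = pref ρ j := by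
    intro j
    induction j with
    | zero => rfl
    | succ j ih =>
      rw [pref_succ, ← ih]
  have hstep : ∀ j, ρ (j + 1) = G.trans (ρ j) (act (pref ρ j) (ρ j)) := by
    intro j
    rw [← hst j]
  have hρ : ρ ∈ G.Plays := ⟨rfl, fun j => ⟨_, hstep j⟩⟩
  refine ⟨ρ, ⟨hρ, ?_⟩, ?_⟩
  · intro j i h
    obtain ⟨s, hs, hi⟩ := h.2
    rw [getLast?_pref, Option.some.injEq] at hs
    subst hs
    subst hi
    rw [hstep j]
    simp only [act, dif_pos h]
  · rintro τ ⟨hτ, hτs⟩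
    have key : ∀ j, pref τ j = pref ρ j ∧ τ j = ρ j := by
      intro j
      induction j with
      | zero =>
        have h0 : τ 0 = ρ 0 := hτ.1.trans hρ.1.symm
        exact ⟨by simp [pref, h0], h0⟩
      | succ j ih =>
        have h := pref_mem_prefPlaysOf hτ j
        have h1 : τ (j + 1) = ρ (j + 1) := by
          rw [hτs j _ h, hstep j, ← ih.1, ← ih.2]
          simp only [act, dif_pos h]
        exact ⟨by rw [pref_succ, pref_succ, ih.1, h1], h1⟩
    funext j
    exact (key j).2

end Arena

/-! ### Büchi and co-Büchi objectives -/

/-- The states that appear infinitely often along `ρ`. -/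
def infStates (ρ : ℕ → S) : Set S := {s | ∀ i, ∃ j, i ≤ j ∧ ρ j = s}

/-- Büchi objective: some state of `T` is visited infinitely often. -/
def buchi (T : Set S) : Set (ℕ → S) := {ρ | (infStates ρ ∩ T).Nonempty}

/-- co-Büchi objective: all states that are visited infinitely often are in `T`. -/
def coBuchi (T : Set S) : Set (ℕ → S) := {ρ | infStates ρ ⊆ T}

/-! ### The decision problems -/

/-- An input: a 2-player arena with finite non-empty sets of states and actions, and, for each of
the two players, the set of states that defines the (Büchi or co-Büchi) objective. -/
structure Instance2 where
  m : ℕ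
  k : ℕ
  arena : Arena 2 (Fin (m + 1)) (Fin (k + 1))
  target : Fin 2 → Finset (Fin (m + 1))

/-- Unary code of a number, with an end mark. -/
def unary (a : ℕ) : List Bool := List.replicate a true ++ [false]

/-- The code of an input as a bit string: the number of states, the number of actions and the
initial state in unary; then, for each state, its owner, its membership in the two target sets,
and the list of its successors in unary, one for each action. -/
def Instance2.encode (I : Instance2) : List Bool :=
  unary (I.m + 1) ++ (unary (I.k + 1) ++ (unary I.arena.init ++
    (List.finRange (I.m + 1)).flatMap fun s =>
      [decide (I.arena.owner s = 1), decide (s ∈ I.target 0), decide (s ∈ I.target 1)] ++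
        (List.finRange (I.k + 1)).flatMap fun a => unary (I.arena.trans s a)))

/-- The problem of deciding whether a 2-player arena with Büchi objectives has a doomsday
equilibrium. -/
def buchiDoomsdayProblem : Language Bool :=
  {w | ∃ I : Instance2, w = I.encode ∧
    I.arena.HasDoomsdayEquilibrium fun i => buchi (I.target i : Set (Fin (I.m + 1)))}

/-- The problem of deciding whether a 2-player arena with co-Büchi objectives has a doomsday
equilibrium. -/
def coBuchiDoomsdayProblem : Language Bool :=
  {w | ∃ I : Instance2, w = I.encode ∧
    I.arena.HasDoomsdayEquilibrium fun i => coBuchi (I.target i : Set (Fin (I.m + 1)))}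

/-! The code determines the input. -/

theorem unary_append_inj {a b : ℕ} {x y : List Bool} (h : unary a ++ x = unary b ++ y) :
    a = b ∧ x = y := by
  induction a generalizing b with
  | zero => cases b <;> simp_all [unary, List.replicate_succ]
  | succ a ih =>
    cases b with
    | zero => simp [unary, List.replicate_succ] at h
    | succ b =>
      have h' : unary a ++ x = unary b ++ y := by
        simpa [unary, List.replicate_succ] using h
      exact ⟨by rw [(ih h').1], (ih h').2⟩

theorem flatMap_append_inj {ι : Type} {f g : ι → List Bool}
    (hfg : ∀ i x y, f i ++ x = g i ++ y → f i = g i ∧ x = y) (l : List ι) {x y : List Bool}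
    (h : l.flatMap f ++ x = l.flatMap g ++ y) : (∀ i ∈ l, f i = g i) ∧ x = y := by
  induction l with
  | nil => simpa using h
  | cons i l ih =>
    simp only [List.flatMap_cons, List.append_assoc] at h
    obtain ⟨h1, h2⟩ := hfg i _ _ h
    obtain ⟨h3, h4⟩ := ih h2
    exact ⟨by simpa [h1] using h3, h4⟩

theorem Instance2.encode_injective : Function.Injective Instance2.encode := by
  rintro ⟨m, k, ⟨o, s₀, d⟩, T⟩ ⟨m', k', ⟨o', s₀', d'⟩, T'⟩ h
  simp only [Instance2.encode] at h
  obtain ⟨hm, h⟩ := unary_append_inj h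
  obtain ⟨hk, h⟩ := unary_append_inj h
  obtain ⟨hs, h⟩ := unary_append_inj h
  obtain rfl : m = m' := by omega
  obtain rfl : k = k' := by omega
  obtain rfl : s₀ = s₀' := Fin.ext hs
  have hin : ∀ (s : Fin (m + 1)) (x y : List Bool),
      ((List.finRange (k + 1)).flatMap fun a => unary (d s a)) ++ x =
        ((List.finRange (k + 1)).flatMap fun a => unary (d' s a)) ++ y →
      (∀ a, d s a = d' s a) ∧ x = y := by
    intro s x y hxy
    obtain ⟨h1, h2⟩ := flatMap_append_inj
      (fun a x y hh => by
        obtain ⟨e1, e2⟩ := unary_append_inj hh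
        exact ⟨by rw [e1], e2⟩) _ hxy
    refine ⟨fun a => ?_, h2⟩
    have h3 := h1 a (List.mem_finRange a)
    exact Fin.ext (unary_append_inj (x := []) (y := []) (by rw [h3])).1
  obtain ⟨h1, -⟩ := flatMap_append_inj (x := []) (y := [])
    (fun s x y hh => by
      simp only [List.cons_append, List.nil_append, List.cons.injEq] at hh
      obtain ⟨e1, e2, e3, e4⟩ := hh
      obtain ⟨e5, e6⟩ := hin s x y e4
      exact ⟨by simp only [e1, e2, e3, e5], e6⟩) _ (congrArg (· ++ []) h)
  have h2 : ∀ s, (o s = 1 ↔ o' s = 1) ∧ (s ∈ T 0 ↔ s ∈ T' 0) ∧ (s ∈ T 1 ↔ s ∈ T' 1) ∧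
      ∀ a, d s a = d' s a := by
    intro s
    have h3 := h1 s (List.mem_finRange s)
    simp only [List.cons_append, List.nil_append, List.cons.injEq, decide_eq_decide] at h3
    exact ⟨h3.1, h3.2.1, h3.2.2.1,
      (hin s [] [] (by simpa using h3.2.2.2)).1⟩
  obtain rfl : o = o' := by
    funext s
    have := (h2 s).1
    omega
  obtain rfl : d = d' := by
    funext s a
    exact (h2 s).2.2.2 a
  obtain rfl : T = T' := by
    funext i
    ext s
    fin_cases i
    · exact (h2 s).2.1
    · exact (h2 s).2.2.1
  rfl

/-! ### Logarithmic-space transducers -/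

/-- Symbols on the input tape: the letters of the input word between two end markers. -/
inductive InSym (A : Type) where
  | leftEnd : InSym A
  | letter : A → InSym A
  | rightEnd : InSym A

/-- Moves of a tape head. -/
inductive Move where
  | left : Move
  | stay : Move
  | right : Move

/-- The new position of the head on a tape that is infinite to the right only. -/
def Move.apply : Move → ℕ → ℕ
  | .left, p => p - 1
  | .stay, p => p
  | .right, p => p + 1

/-- A deterministic Turing machine with a two-way read-only input tape, finitely many work tapes
(indexed by `K`), and a write-only output tape. In each step, depending on its state and on the
scanned symbols, the machine either halts (`none`), or changes the state, moves the input head,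
writes a symbol and moves the head on each work tape, and appends a word to the output. -/
structure Transducer (A B : Type) where
  Q : Type
  K : Type
  Γ : Type
  [finiteQ : Finite Q]
  [finiteK : Finite K]
  [finiteΓ : Finite Γ]
  start : Q
  blank : Γ
  δ : Q → InSym A → (K → Γ) → Option (Q × Move × (K → Γ × Move) × List B)

namespace Transducer

variable {A B : Type}

/-- A configuration: state, position of the input head, positions of the heads on the work tapes,
contents of the work tapes, and the output so far. -/
structure Config (M : Transducer A B) where
  state : M.Q
  inPos : ℕ
  pos : M.K → ℕ
  tape : M.K → ℕ → M.Γ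
  out : List B

/-- The symbol on cell `p` of the input tape: the input word occupies the cells
`1, …, w.length`. -/
def inputSymbol (w : List A) (p : ℕ) : InSym A :=
  if p = 0 then .leftEnd
  else match w[p - 1]? with
    | some a => .letter a
    | none => .rightEnd

variable (M : Transducer A B)

/-- The initial configuration: all work tapes are blank. -/
def initial : M.Config where
  state := M.start
  inPos := 0
  pos := fun _ => 0
  tape := fun _ _ => M.blank
  out := []

/-- What the machine does in a configuration, on input `w`. -/
def action (w : List A) (c : M.Config) : Option (M.Q × Move × (M.K → M.Γ × Move) × List B) :=
  M.δ c.state (inputSymbol w c.inPos) fun k => c.tape k (c.pos k)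

/-- The machine halts in this configuration. -/
def Halted (w : List A) (c : M.Config) : Prop := M.action w c = none

/-- One step on input `w`; a halted machine stays where it is. The input head does not leave the
cells `0, …, w.length + 1`. -/
def next (w : List A) (c : M.Config) : M.Config :=
  match M.action w c with
  | none => c
  | some (q, d, u, o) =>
    { state := q
      inPos := min (d.apply c.inPos) (w.length + 1)
      pos := fun k => (u k).2.apply (c.pos k)
      tape := fun k => Function.update (c.tape k) (c.pos k) (u k).1
      out := c.out ++ o }

/-- The configuration after `t` steps on input `w`. -/
def run (w : List A) (t : ℕ) : M.Config := (M.next w)^[t] M.initial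

/-- The machine computes `f` in logarithmic space: on each input `w` it halts with output `f w`,
and its heads visit only the first `c * (log |w| + 1)` cells of the work tapes. -/
def ComputesInLogSpace (f : List A → List B) : Prop :=
  ∃ c : ℕ, ∀ w : List A,
    (∃ t, M.Halted w (M.run w t) ∧ (M.run w t).out = f w) ∧
      ∀ t k, (M.run w t).pos k < c * (Nat.log 2 w.length + 1)

end Transducer

/-! ### Hardness for polynomial time -/

/-- `f` is computable in logarithmic space. -/
def LogSpaceComputable {A B : Type} (f : List A → List B) : Prop :=
  ∃ M : Transducer A B, M.ComputesInLogSpace f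

/-- Logarithmic-space many-one reducibility. -/
def LogSpaceReducible {A B : Type} (L : Language A) (L' : Language B) : Prop :=
  ∃ f : List A → List B, LogSpaceComputable f ∧ ∀ w, w ∈ L ↔ f w ∈ L'

open Classical in
/-- `L` belongs to the class PTIME: its characteristic function is computed by a Turing machine in
polynomial time. -/
def InPTime {A : Type} (L : Language A) : Prop :=
  Nonempty (Turing.TM2ComputableInPolyTime (fun w : List A => w) Computability.encodeBool
    fun w => decide (w ∈ L))

/-- `L'` is PTIME-hard: each language in PTIME, over any finite alphabet, reduces to `L'` in
logarithmic space. -/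
def PTimeHard {B : Type} (L' : Language B) : Prop :=
  ∀ (A : Type) [Finite A] (L : Language A), InPTime L → LogSpaceReducible L L'

end Doomsday

/-! Let every state be a target of Player 2. That objective then holds on all plays, so condition 2
for Player 1 says that λ₁ enforces φ₁ against every behaviour of Player 2, and the remaining
conditions follow from this. A doomsday equilibrium exists iff Player 1 wins the zero-sum game for
φ₁. If T₁ is moreover absorbing, Büchi and co-Büchi both mean that T₁ is reached (`mem_buchi_iff`,
`mem_coBuchi_iff`), so one reduction to reachability games serves both parts
(`pTimeHard_of_forall_iff`).

A polynomial-time machine is unfolded into a stack machine that touches the top of one stack per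
step. Its run is verified backwards by a game. Player 1 defends a claim about time t + 1 (a control
state, or the content of a stack cell counted from the top) by naming the control state and the top
symbol at time t. Player 2 either challenges the named control state or asks for what then remains
of the claim. As the machine is deterministic, Player 1 wins exactly from the true claims
(`holds_succ_iff`, `hasDoomsdayEquilibrium_iff_good`); the game starts from the claim that the
machine accepts. A claim concerns one cell only, and pushes and pops move it by one position, so a
game position is a time, a depth and a bounded amount of control.

Times and depths are taken below N = B ^ (log₂ |w| + 1), where the constant B is so large that N - 1
exceeds the time bound (`exists_base_pow_ge`). A coordinate is thus a string of log₂ |w| + 1 digits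
in base B. The arena is printed by a machine that sweeps over such strings: one sweep adds or
subtracts one with carry and reports overflow (`sweep_cellOp`), counting the input letters in binary
yields a memory of the right length (`length_counter`), and nested loops print the code
(`logSpaceComputable_encode`). -/

namespace Doomsday

/-! ### Doomsday equilibria and reachability games -/

namespace Arena

variable {S Act : Type}

/-- The strategy of Player `i` that plays according to `f`, which depends on the last state only. -/
noncomputable def positional (G : Arena 2 S Act) (f : S → Act) (i : Fin 2) : G.Strategy i :=
  fun π => f π.2.2.choose

theorem positional_apply (G : Arena 2 S Act) (f : S → Act) (i : Fin 2) (ρ : ℕ → S) (j : ℕ)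
    (h : pref ρ j ∈ G.PrefPlaysOf i) : G.positional f i ⟨pref ρ j, h⟩ = f (ρ j) := by
  exact congrArg f (Option.some.inj ((getLast?_pref ρ j).symm.trans h.2.choose_spec.1)).symm

/-- If the objective of Player 2 is trivial and Player 1 has to reach an absorbing set `T`, and if
`Good` is the set of winning states of the well-founded reachability game, then there is a
doomsday equilibrium iff the initial state is good. -/
theorem hasDoomsdayEquilibrium_iff [Nonempty Act] (G : Arena 2 S Act) (φ : Fin 2 → Set (ℕ → S))
    (T : Set S) (hφ₁ : ∀ ρ, ρ ∈ φ 1) (hφ₀ : ∀ ρ ∈ G.Plays, ρ ∈ φ 0 ↔ ∃ j, ρ j ∈ T)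
    (Inv Good : S → Prop) (rank : S → ℕ) (hinit : Inv G.init)
    (hInv : ∀ s a, Inv s → Inv (G.trans s a)) (hT : ∀ s, Inv s → s ∈ T → Good s)
    (hP1 : ∀ s, Inv s → s ∉ T → G.owner s = 0 → (Good s ↔ ∃ a, Good (G.trans s a)))
    (hP2 : ∀ s, Inv s → s ∉ T → G.owner s = 1 → (Good s ↔ ∀ a, Good (G.trans s a)))
    (hrank : ∀ s a, Inv s → s ∉ T → Good s → rank (G.trans s a) < rank s) :
    G.HasDoomsdayEquilibrium φ ↔ Good G.init := by
  classical
  have hInvPlay : ∀ ρ ∈ G.Plays, ∀ j, Inv (ρ j) := by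
    intro ρ hρ j
    induction j with
    | zero => rw [hρ.1]; exact hinit
    | succ j ih =>
      obtain ⟨a, ha⟩ := hρ.2 j
      rw [ha]
      exact hInv _ _ ih
  have howner : ∀ s, G.owner s = 0 ∨ G.owner s = 1 := fun s => by omega
  constructor
  · rintro ⟨Λ, -, hΛ⟩
    by_contra hbad
    -- From a bad state Player 2 can always move to a bad state; this gives a positional spoiling
    -- strategy.
    have hf : ∀ s, ∃ a, Inv s → s ∉ T → G.owner s = 1 → ¬ Good s → ¬ Good (G.trans s a) := by
      intro s
      by_cases hs : Inv s ∧ s ∉ T ∧ G.owner s = 1 ∧ ¬ Good s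
      · have := hs.2.2.2
        rw [hP2 s hs.1 hs.2.1 hs.2.2.1] at this
        push Not at this
        obtain ⟨a, ha⟩ := this
        exact ⟨a, fun _ _ _ _ => ha⟩
      · exact ⟨Classical.arbitrary Act, fun h1 h2 h3 h4 => (hs ⟨h1, h2, h3, h4⟩).elim⟩
    choose f hf using hf
    obtain ⟨ρ, ⟨hρ, hρs⟩, -⟩ :=
      G.existsUnique_isOutcome (Function.update (fun i => G.positional f i) 0 (Λ 0))
    have hbadj : ∀ j, ¬ Good (ρ j) := by
      intro j
      induction j with
      | zero => rwa [hρ.1]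
      | succ j ih =>
        have hI := hInvPlay ρ hρ j
        have hnT : ρ j ∉ T := fun h => ih (hT _ hI h)
        rcases howner (ρ j) with h | h
        · obtain ⟨a, ha⟩ := hρ.2 j
          rw [ha]
          intro hg
          exact ih ((hP1 _ hI hnT h).2 ⟨a, hg⟩)
        · have hm := pref_mem_prefPlaysOf hρ j
          rw [h] at hm
          have h2 := hρs j 1 hm
          rw [Function.update_of_ne (by decide), positional_apply] at h2
          rw [h2]
          exact hf _ hI hnT h ih
    have hout : ρ ∈ G.outcome 0 (Λ 0) := by
      refine ⟨hρ, fun j h => ?_⟩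
      have := hρs j 0 h
      rwa [Function.update_self] at this
    have hn : ρ ∉ φ 0 := by
      rw [hφ₀ ρ hρ]
      rintro ⟨j, hj⟩
      exact hbadj j (hT _ (hInvPlay ρ hρ j) hj)
    -- The spoiled play violates the objective of Player 1 but not the trivial one of Player 2,
    -- against condition 2.
    exact hΛ 0 ρ hout hn 1 (hφ₁ ρ)
  · intro hgood
    have hf : ∀ s, ∃ a, Inv s → s ∉ T → G.owner s = 0 → Good s → Good (G.trans s a) := by
      intro s
      by_cases hs : Inv s ∧ s ∉ T ∧ G.owner s = 0 ∧ Good s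
      · obtain ⟨a, ha⟩ := (hP1 s hs.1 hs.2.1 hs.2.2.1).1 hs.2.2.2
        exact ⟨a, fun _ _ _ _ => ha⟩
      · exact ⟨Classical.arbitrary Act, fun h1 h2 h3 h4 => (hs ⟨h1, h2, h3, h4⟩).elim⟩
    choose f hf using hf
    have hwin : ∀ ρ ∈ G.outcome 0 (G.positional f 0), ρ ∈ φ 0 := by
      rintro ρ ⟨hρ, hρs⟩
      rw [hφ₀ ρ hρ]
      by_contra hno
      push Not at hno
      -- While the play avoids `T` it stays good and its rank drops in each step, which is possible
      -- at most `rank G.init` times.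
      have key : ∀ j, Good (ρ j) ∧ rank (ρ j) + j ≤ rank G.init := by
        intro j
        induction j with
        | zero => rw [hρ.1]; exact ⟨hgood, le_rfl⟩
        | succ j ih =>
          have hI := hInvPlay ρ hρ j
          have hg : Good (ρ (j + 1)) := by
            rcases howner (ρ j) with h | h
            · have hm := pref_mem_prefPlaysOf hρ j
              rw [h] at hm
              rw [hρs j hm, positional_apply]
              exact hf _ hI (hno j) h ih.1
            · obtain ⟨a, ha⟩ := hρ.2 j
              rw [ha]
              exact (hP2 _ hI (hno j) h).1 ih.1 a
          obtain ⟨a, ha⟩ := hρ.2 j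
          have := hrank _ a hI (hno j) ih.1
          rw [← ha] at this
          exact ⟨hg, by omega⟩
      have := (key (rank G.init + 1)).2
      omega
    refine ⟨fun i => G.positional f i, ?_, ?_⟩
    · obtain ⟨ρ, ⟨hρ, hρs⟩, -⟩ := G.existsUnique_isOutcome (fun i => G.positional f i)
      have h0 := hwin ρ ⟨hρ, fun j h => hρs j 0 h⟩
      refine ⟨ρ, ⟨hρ, hρs⟩, fun i => ?_⟩
      fin_cases i
      · exact h0
      · exact hφ₁ ρ
    · intro i ρ hρ hn
      fin_cases i
      · exact (hn (hwin ρ hρ)).elim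
      · exact (hn (hφ₁ ρ)).elim

end Arena

/-! ### Büchi and co-Büchi objectives of absorbing sets -/

section Objectives

variable {S Act : Type}

theorem infStates_nonempty [Finite S] (ρ : ℕ → S) : (infStates ρ).Nonempty := by
  obtain ⟨s, hs⟩ := Finite.exists_infinite_fiber ρ
  refine ⟨s, fun i => ?_⟩
  have hs' : (ρ ⁻¹' {s}).Infinite := Set.infinite_coe_iff.1 hs
  obtain ⟨j, hj, hij⟩ := hs'.exists_gt i
  exact ⟨j, hij.le, hj⟩

theorem Arena.mem_of_le {n : ℕ} {G : Arena n S Act} {T : Set S}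
    (hT : ∀ s a, s ∈ T → G.trans s a ∈ T) {ρ : ℕ → S} (hρ : ρ ∈ G.Plays) {i j : ℕ} (hij : i ≤ j)
    (hi : ρ i ∈ T) : ρ j ∈ T := by
  induction j, hij using Nat.le_induction with
  | base => exact hi
  | succ j _ ih =>
    obtain ⟨a, ha⟩ := hρ.2 j
    rw [ha]
    exact hT _ _ ih

/-- By finiteness some state recurs; once the play has entered the absorbing set, a late occurrence
of that state lies in it. -/
theorem mem_buchi_iff [Finite S] {n : ℕ} {G : Arena n S Act} {T : Set S}
    (hT : ∀ s a, s ∈ T → G.trans s a ∈ T) {ρ : ℕ → S} (hρ : ρ ∈ G.Plays) :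
    ρ ∈ buchi T ↔ ∃ j, ρ j ∈ T := by
  constructor
  · rintro ⟨s, hs, hsT⟩
    obtain ⟨j, -, rfl⟩ := hs 0
    exact ⟨j, hsT⟩
  · rintro ⟨i, hi⟩
    obtain ⟨s, hs⟩ := infStates_nonempty ρ
    obtain ⟨j, hij, rfl⟩ := hs i
    exact ⟨_, hs, Arena.mem_of_le hT hρ hij hi⟩

/-- A recurring state exists and shows that `T` is visited; after such a visit every recurring state
occurs inside `T`. -/
theorem mem_coBuchi_iff [Finite S] {n : ℕ} {G : Arena n S Act} {T : Set S}
    (hT : ∀ s a, s ∈ T → G.trans s a ∈ T) {ρ : ℕ → S} (hρ : ρ ∈ G.Plays) :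
    ρ ∈ coBuchi T ↔ ∃ j, ρ j ∈ T := by
  constructor
  · intro h
    obtain ⟨s, hs⟩ := infStates_nonempty ρ
    obtain ⟨j, -, rfl⟩ := hs 0
    exact ⟨j, h hs⟩
  · rintro ⟨i, hi⟩ s hs
    obtain ⟨j, hij, rfl⟩ := hs i
    exact Arena.mem_of_le hT hρ hij hi

theorem mem_buchi_univ [Finite S] (ρ : ℕ → S) : ρ ∈ buchi (Set.univ : Set S) := by
  obtain ⟨s, hs⟩ := infStates_nonempty ρ
  exact ⟨s, hs, trivial⟩

theorem mem_coBuchi_univ (ρ : ℕ → S) : ρ ∈ coBuchi (Set.univ : Set S) :=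
  fun _ _ => trivial

end Objectives


/-! ### Stack machines -/

/-- What a stack machine does with the selected stack. -/
inductive StackOp (Γ : Type) where
  | keep : StackOp Γ
  | pop : StackOp Γ
  | push : Γ → StackOp Γ

def StackOp.apply {Γ : Type} : StackOp Γ → List Γ → List Γ
  | .keep, l => l
  | .pop, l => l.tail
  | .push g, l => g :: l

/-- A deterministic machine that, in each step, reads the top of one stack, changes its control
state and operates on the top of that stack. -/
structure StackMachine (C K Γ : Type) where
  sel : C → K
  op : C → StackOp Γ
  nxt : C → Option Γ → C

namespace StackMachine

structure Cfg (C K Γ : Type) where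
  ctl : C
  stk : K → List Γ

variable {C K Γ : Type} (M : StackMachine C K Γ)

/-- The operation depends on the control state alone and only `nxt` reads the top symbol. A claim
about a cell can therefore be traced back one step from the control state only. -/
def step [DecidableEq K] (c : Cfg C K Γ) : Cfg C K Γ where
  ctl := M.nxt c.ctl (c.stk (M.sel c.ctl)).head?
  stk := Function.update c.stk (M.sel c.ctl) ((M.op c.ctl).apply (c.stk (M.sel c.ctl)))

/-- The restriction of a machine to sets of control states and stack symbols that are closed under
its transitions. -/
def restrict (C₀ : Set C) (Γ₀ : Set Γ)
    (hC : ∀ c ∈ C₀, ∀ o : Option Γ, M.nxt c o ∈ C₀)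
    (hΓ : ∀ c ∈ C₀, ∀ g, M.op c = .push g → g ∈ Γ₀) : StackMachine C₀ K Γ₀ where
  sel c := M.sel c
  op c := match h : M.op c with
    | .keep => .keep
    | .pop => .pop
    | .push g => .push ⟨g, hΓ c c.2 g h⟩
  nxt c o := ⟨M.nxt c (o.map Subtype.val), hC c c.2 _⟩

theorem restrict_op_apply (C₀ : Set C) (Γ₀ : Set Γ) (hC hΓ) (c : C₀) (l : List Γ₀) :
    (((M.restrict C₀ Γ₀ hC hΓ).op c).apply l).map Subtype.val =
      (M.op c).apply (l.map Subtype.val) := by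
  simp only [restrict]
  split <;> rename_i h <;> simp [h, StackOp.apply]

def Cfg.val {C₀ : Set C} {Γ₀ : Set Γ} (c : Cfg C₀ K Γ₀) : Cfg C K Γ where
  ctl := c.ctl
  stk k := (c.stk k).map Subtype.val

theorem val_restrict_step [DecidableEq K] (C₀ : Set C) (Γ₀ : Set Γ) (hC hΓ) (c : Cfg C₀ K Γ₀) :
    ((M.restrict C₀ Γ₀ hC hΓ).step c).val = M.step c.val := by
  simp only [step, Cfg.val]
  congr 1
  · exact congrArg (M.nxt c.ctl) List.head?_map.symm
  · funext k
    by_cases hk : k = M.sel c.ctl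
    · subst hk
      have := M.restrict_op_apply C₀ Γ₀ hC hΓ c.ctl (c.stk (M.sel c.ctl))
      simpa [restrict] using this
    · simp [restrict, Function.update_of_ne hk]

/-- `TM2` statements form an infinite type, of which one machine uses finitely many. This transfers
runs to the finite restriction. -/
theorem val_restrict_iterate [DecidableEq K] (C₀ : Set C) (Γ₀ : Set Γ) (hC hΓ)
    (c : Cfg C₀ K Γ₀) (t : ℕ) :
    ((M.restrict C₀ Γ₀ hC hΓ).step^[t] c).val = M.step^[t] c.val := by
  induction t with
  | zero => rfl
  | succ t ih => rw [Function.iterate_succ_apply', Function.iterate_succ_apply', val_restrict_step, ih]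

end StackMachine

/-! ### Simulation of TM2 machines -/

namespace TM2Sim

open Turing

variable {K : Type} [DecidableEq K] {Γ : K → Type} {Λ σ : Type}

/-- The symbol of stack `k`, if it is one. -/
def proj (k : K) (o : Option (Σ k, Γ k)) : Option (Γ k) :=
  o.bind fun x => if h : x.1 = k then some (h ▸ x.2) else none

theorem proj_map (k : K) (o : Option (Γ k)) : proj k (o.map (Sigma.mk k)) = o := by
  cases o <;> simp [proj]

/-- The stack machine that executes the elementary statements of a TM2 machine one by one. -/
def machine (k₀ : K) (m : Λ → TM2.Stmt Γ Λ σ) :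
    StackMachine (Option (TM2.Stmt Γ Λ σ) × σ) K (Σ k, Γ k) where
  sel c := match c.1 with
    | some (.push k _ _) => k
    | some (.peek k _ _) => k
    | some (.pop k _ _) => k
    | _ => k₀
  op c := match c.1 with
    | some (.push k f _) => .push ⟨k, f c.2⟩
    | some (.pop _ _ _) => .pop
    | _ => .keep
  nxt c o := match c.1 with
    | some (.push _ _ q) => (some q, c.2)
    | some (.peek k f q) => (some q, f c.2 (proj k o))
    | some (.pop k f q) => (some q, f c.2 (proj k o))
    | some (.load f q) => (some q, f c.2)
    | some (.branch f q₁ q₂) => (some (cond (f c.2) q₁ q₂), c.2)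
    | some (.goto l) => (some (m (l c.2)), c.2)
    | some .halt => (none, c.2)
    | none => (none, c.2)

def embStacks (S : ∀ k, List (Γ k)) (k : K) : List (Σ k, Γ k) := (S k).map (Sigma.mk k)

def emb (m : Λ → TM2.Stmt Γ Λ σ) (c : TM2.Cfg Γ Λ σ) :
    StackMachine.Cfg (Option (TM2.Stmt Γ Λ σ) × σ) K (Σ k, Γ k) :=
  ⟨(c.l.map m, c.var), embStacks c.stk⟩

theorem embStacks_update (S : ∀ k, List (Γ k)) (k : K) (l : List (Γ k)) :
    embStacks (Function.update S k l) = Function.update (embStacks S) k (l.map (Sigma.mk k)) := by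
  funext k'
  by_cases h : k' = k
  · subst h
    simp [embStacks]
  · simp [embStacks, Function.update_of_ne h]

/-- The number of elementary steps that a statement takes at most. -/
def depth : TM2.Stmt Γ Λ σ → ℕ
  | .push _ _ q => depth q + 1
  | .peek _ _ q => depth q + 1
  | .pop _ _ q => depth q + 1
  | .load _ q => depth q + 1
  | .branch _ q₁ q₂ => max (depth q₁) (depth q₂) + 1
  | .goto _ => 1
  | .halt => 1

/-- One `TM2` step executes a whole statement; by induction on the statement, each constructor on
the executed path costs one step. -/
theorem exists_iterate_stepAux (k₀ : K) (m : Λ → TM2.Stmt Γ Λ σ) (q : TM2.Stmt Γ Λ σ) (v : σ)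
    (S : ∀ k, List (Γ k)) :
    ∃ j ≤ depth q, (machine k₀ m).step^[j] ⟨(some q, v), embStacks S⟩ =
      emb m (TM2.stepAux q v S) := by
  induction q generalizing v S with
  | push k f q ih =>
    obtain ⟨j, hj, h⟩ := ih v (Function.update S k (f v :: S k))
    refine ⟨j + 1, by simpa [depth] using hj, ?_⟩
    rw [Function.iterate_succ_apply, TM2.stepAux, ← h, embStacks_update]
    rfl
  | peek k f q ih =>
    obtain ⟨j, hj, h⟩ := ih (f v (S k).head?) S
    refine ⟨j + 1, by simpa [depth] using hj, ?_⟩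
    rw [Function.iterate_succ_apply, TM2.stepAux, ← h]
    congr 1
    have hh : (embStacks S k).head? = (S k).head?.map (Sigma.mk k) := List.head?_map
    simp [StackMachine.step, machine, StackOp.apply, hh, proj_map]
  | pop k f q ih =>
    obtain ⟨j, hj, h⟩ := ih (f v (S k).head?) (Function.update S k (S k).tail)
    refine ⟨j + 1, by simpa [depth] using hj, ?_⟩
    rw [Function.iterate_succ_apply, TM2.stepAux, ← h, embStacks_update]
    simp [StackMachine.step, machine, StackOp.apply, embStacks, proj_map]
  | load f q ih =>
    obtain ⟨j, hj, h⟩ := ih (f v) S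
    refine ⟨j + 1, by simpa [depth] using hj, ?_⟩
    rw [Function.iterate_succ_apply, TM2.stepAux, ← h]
    simp [StackMachine.step, machine, StackOp.apply]
  | branch f q₁ q₂ ih₁ ih₂ =>
    have hs : (machine k₀ m).step ⟨(some (.branch f q₁ q₂), v), embStacks S⟩ =
        ⟨(some (cond (f v) q₁ q₂), v), embStacks S⟩ := by
      simp [StackMachine.step, machine, StackOp.apply]
    cases hf : f v with
    | true =>
      obtain ⟨j, hj, h⟩ := ih₁ v S
      refine ⟨j + 1, by simp only [depth]; omega, ?_⟩
      rw [Function.iterate_succ_apply, TM2.stepAux, hs, hf, cond_true, h, cond_true]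
    | false =>
      obtain ⟨j, hj, h⟩ := ih₂ v S
      refine ⟨j + 1, by simp only [depth]; omega, ?_⟩
      rw [Function.iterate_succ_apply, TM2.stepAux, hs, hf, cond_false, h, cond_false]
  | goto l =>
    exact ⟨1, le_rfl, by simp [StackMachine.step, machine, StackOp.apply, emb]⟩
  | halt =>
    exact ⟨1, le_rfl, by simp [StackMachine.step, machine, StackOp.apply, emb]⟩

theorem exists_iterate_emb (k₀ : K) (m : Λ → TM2.Stmt Γ Λ σ) {D : ℕ} (hD : ∀ l, depth (m l) ≤ D)
    {n : ℕ} {c c' : TM2.Cfg Γ Λ σ} (h : (flip bind (TM2.step m))^[n] (some c) = some c') :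
    ∃ j ≤ D * n, (machine k₀ m).step^[j] (emb m c) = emb m c' := by
  induction n generalizing c with
  | zero =>
    obtain rfl : c = c' := by simpa using h
    exact ⟨0, le_rfl, rfl⟩
  | succ n ih =>
    rw [Function.iterate_succ_apply] at h
    obtain ⟨l, v, S⟩ := c
    cases l with
    | none =>
      -- A halted configuration steps to `none`, which persists, so the run could not end in `some
      -- c'`.
      have hnone : ∀ n, (flip bind (TM2.step m))^[n] none = none := by
        intro n
        induction n with
        | zero => rfl
        | succ n ih => rw [Function.iterate_succ_apply]; exact ih
      have h' : (flip bind (TM2.step m))^[n] none = some c' := h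
      rw [hnone] at h'
      cases h'
    | some l =>
      obtain ⟨j, hj, h1⟩ := exists_iterate_stepAux k₀ m (m l) v S
      obtain ⟨j', hj', h2⟩ := ih (c := TM2.stepAux (m l) v S) h
      refine ⟨j' + j, ?_, ?_⟩
      · have := hD l
        rw [Nat.mul_succ]
        omega
      · rw [Function.iterate_add_apply]
        exact (congrArg _ h1).trans h2

/-- Halting becomes a fixed point, so the answer may be read at any time after the time bound. -/
theorem step_emb_halted (k₀ : K) (m : Λ → TM2.Stmt Γ Λ σ) {c : TM2.Cfg Γ Λ σ} (h : c.l = none) :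
    (machine k₀ m).step (emb m c) = emb m c := by
  simp [StackMachine.step, machine, StackOp.apply, emb, h]

/-- The finite set `TM2.stmts` is closed under substatements and contains `none` and the target of
every `goto`. -/
theorem nxt_mem_stmts [Fintype Λ] (k₀ : K) (m : Λ → TM2.Stmt Γ Λ σ)
    (c : Option (TM2.Stmt Γ Λ σ) × σ) (hc : c.1 ∈ TM2.stmts m Finset.univ)
    (o : Option (Σ k, Γ k)) : ((machine k₀ m).nxt c o).1 ∈ TM2.stmts m Finset.univ := by
  obtain ⟨q, v⟩ := c
  have hnone : none ∈ TM2.stmts m Finset.univ := by simp [TM2.stmts]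
  have hsub : ∀ {q₁ q₂ : TM2.Stmt Γ Λ σ}, q₁ ∈ TM2.stmts₁ q₂ →
    some q₂ ∈ TM2.stmts m Finset.univ → some q₁ ∈ TM2.stmts m Finset.univ :=
    fun h => TM2.stmts_trans h
  cases q with
  | none => exact hnone
  | some q =>
    cases q with
    | branch f q₁ q₂ =>
      refine hsub ?_ hc
      cases h : f v <;> simp [TM2.stmts₁, TM2.stmts₁_self]
    | goto l =>
      simp only [machine, TM2.stmts, Finset.mem_insertNone, Finset.mem_biUnion, Option.mem_def,
        Option.some.injEq, forall_eq']
      exact ⟨l v, Finset.mem_univ _, TM2.stmts₁_self⟩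
    | halt => exact hnone
    | _ => exact hsub (by simp [TM2.stmts₁, TM2.stmts₁_self]) hc

/-- The stack symbols that can occur. -/
def symbols [Fintype Λ] (k₀ : K) (y : Σ k, Γ k) (m : Λ → TM2.Stmt Γ Λ σ) : Set (Σ k, Γ k) :=
  Set.range (Sigma.mk k₀) ∪ {y} ∪ ⋃ q ∈ TM2.stmts m Finset.univ, ⋃ v : σ,
    {x | (machine k₀ m).op (q, v) = .push x}

/-- A statement together with a value of the variable pushes at most one symbol, and there are
finitely many such pairs. The alphabets of the stacks other than `k₀` may be infinite. -/
theorem finite_symbols [Fintype Λ] [Finite σ] (k₀ : K) [Finite (Γ k₀)] (y : Σ k, Γ k)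
    (m : Λ → TM2.Stmt Γ Λ σ) : (symbols k₀ y m).Finite := by
  refine ((Set.finite_range _).union (Set.finite_singleton y)).union ?_
  refine (Finset.finite_toSet _).biUnion fun q _ => Set.finite_iUnion fun v => ?_
  refine Set.Subsingleton.finite fun x hx x' hx' => ?_
  simpa using hx.symm.trans hx'

end TM2Sim

open TM2Sim in
/-- A language in PTIME is decided in polynomial time by a stack machine with finitely many control
states, stacks and symbols. -/
theorem InPTime.exists_stackMachine {A : Type} {L : Language A} (h : InPTime L) :
    ∃ (C K Γ : Type) (_ : Finite C) (_ : Finite K) (_ : Finite Γ) (_ : DecidableEq K)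
      (M : StackMachine C K Γ) (c₀ : C) (k₀ k₁ : K) (letter : A → Γ) (yes : Γ)
      (P : Polynomial ℕ), ∀ (w : List A) (t : ℕ), P.eval w.length ≤ t →
        (w ∈ L ↔ ((M.step^[t] ⟨c₀, Function.update (fun _ => []) k₀ (w.map letter)⟩).stk k₁)[0]? =
          some yes) := by
  classical
  obtain ⟨⟨tm, inA, outA⟩, time, hout⟩ := h
  obtain ⟨k₀, k₁, Γ, Λ, main, σ, v₀, m⟩ := tm
  dsimp only at inA outA hout
  rename_i K _ _ _ _ _
  let y : Σ k, Γ k := ⟨k₁, outA.symm true⟩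
  let C₀ : Set (Option (Turing.TM2.Stmt Γ Λ σ) × σ) := {c | c.1 ∈ Turing.TM2.stmts m Finset.univ}
  let Γ₀ := symbols k₀ y m
  have hC₀ : C₀.Finite := by
    refine (((Finset.finite_toSet (Turing.TM2.stmts m Finset.univ)).prod
      (Set.finite_univ (α := σ)))).subset ?_
    rintro ⟨q, v⟩ hq
    exact ⟨hq, trivial⟩
  have hΓ : ∀ c ∈ C₀, ∀ g, (machine k₀ m).op c = .push g → g ∈ Γ₀ := by
    rintro ⟨q, v⟩ hq g hg
    refine Or.inr ?_
    simp only [Set.mem_iUnion]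
    exact ⟨q, hq, v, hg⟩
  have hc₀ : (some (m main), v₀) ∈ C₀ := by
    simp only [C₀, Set.mem_ofPred_eq, Turing.TM2.stmts, Finset.mem_insertNone, Finset.mem_biUnion,
      Option.mem_def, Option.some.injEq, forall_eq']
    exact ⟨main, Finset.mem_univ _, Turing.TM2.stmts₁_self⟩
  -- Every `TM2` step costs at most `D` elementary steps, whence the time bound `D * time`.
  let D := Finset.univ.sup fun l => depth (m l)
  have hD : ∀ l, depth (m l) ≤ D := fun l => Finset.le_sup (f := fun l => depth (m l)) (Finset.mem_univ l)
  refine ⟨C₀, K, Γ₀, hC₀.to_subtype, inferInstance, (finite_symbols k₀ y m).to_subtype, inferInstance,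
    (machine k₀ m).restrict C₀ Γ₀ (fun c hc o => nxt_mem_stmts k₀ m c hc o) hΓ, ⟨_, hc₀⟩, k₀, k₁,
    fun a => ⟨⟨k₀, inA.symm a⟩, Or.inl (Or.inl ⟨_, rfl⟩)⟩, ⟨y, Or.inl (Or.inr rfl)⟩,
    Polynomial.C D * time, fun w t ht => ?_⟩
  obtain ⟨⟨steps, hev⟩, hle⟩ := hout w
  obtain ⟨j, hj, hrun⟩ := exists_iterate_emb k₀ m hD hev
  have hjt : j ≤ t := by
    refine hj.trans (le_trans (Nat.mul_le_mul_left D hle) ?_)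
    simpa using ht
  have hinit : emb m (Turing.initList ⟨k₀, k₁, Γ, Λ, main, σ, v₀, m⟩ (w.map inA.invFun)) =
      ⟨(some (m main), v₀), Function.update (fun _ => []) k₀ (w.map fun a => ⟨k₀, inA.symm a⟩)⟩ := by
    simp only [emb, Turing.initList, Option.map_some]
    congr 1
    funext k
    by_cases hk : k = k₀
    · subst hk
      simp [embStacks]
    · simp [embStacks, hk]
  have hhalt := Function.iterate_fixed (step_emb_halted k₀ m (c := Turing.haltList
    ⟨k₀, k₁, Γ, Λ, main, σ, v₀, m⟩ ((Computability.encodeBool (decide (w ∈ L))).map outA.invFun)) rfl)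
    (t - j)
  have hval := (machine k₀ m).val_restrict_iterate C₀ Γ₀ (fun c hc o => nxt_mem_stmts k₀ m c hc o) hΓ
    ⟨⟨_, hc₀⟩, Function.update (fun _ => []) k₀
      (w.map fun a => ⟨⟨k₀, inA.symm a⟩, Or.inl (Or.inl ⟨_, rfl⟩)⟩)⟩ t
  have hstart : (⟨⟨_, hc₀⟩, Function.update (fun _ => []) k₀
      (w.map fun a => ⟨⟨k₀, inA.symm a⟩, Or.inl (Or.inl ⟨_, rfl⟩)⟩)⟩ :
      StackMachine.Cfg C₀ K Γ₀).val = emb m (Turing.initList ⟨k₀, k₁, Γ, Λ, main, σ, v₀, m⟩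
        (w.map inA.invFun)) := by
    rw [hinit]
    simp only [StackMachine.Cfg.val]
    congr 1
    funext k
    by_cases hk : k = k₀
    · subst hk
      simp
    · simp [hk]
  have hiter : (machine k₀ m).step^[t] (emb m (Turing.initList ⟨k₀, k₁, Γ, Λ, main, σ, v₀, m⟩
        (w.map inA.invFun))) = emb m (Turing.haltList ⟨k₀, k₁, Γ, Λ, main, σ, v₀, m⟩
          ((Computability.encodeBool (decide (w ∈ L))).map outA.invFun)) := by
    rw [← Nat.sub_add_cancel hjt, Function.iterate_add_apply]
    exact (congrArg _ hrun).trans hhalt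
  rw [hstart, hiter] at hval
  have hstk := congrFun (congrArg StackMachine.Cfg.stk hval) k₁
  have hstk' := congrArg (fun l => l[0]?) hstk
  simp only [StackMachine.Cfg.val, emb, embStacks, Turing.haltList, List.getElem?_map] at hstk'
  -- The restricted alphabet embeds injectively, so the top symbol can be compared with the code of
  -- `true` in the full alphabet.
  refine Iff.trans ?_ (Option.map_injective Subtype.val_injective).eq_iff
  rw [hstk']
  simp [Computability.encodeBool, y]


/-! ### Games on a grid -/

/-- Changes of a coordinate modulo `N`. -/
inductive Shift where
  | keep : Shift
  | zero : Shift
  | inc : Shift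
  | dec : Shift

def Shift.apply (N : ℕ) : Shift → ℕ → ℕ
  | .keep, p => p
  | .zero, _ => 0
  | .inc, p => (p + 1) % N
  | .dec, p => (p + N - 1) % N

theorem Shift.apply_keep (N p : ℕ) : Shift.keep.apply N p = p := rfl

theorem Shift.apply_lt {N p : ℕ} (d : Shift) (hp : p < N) : d.apply N p < N := by
  have : 0 < N := by omega
  cases d
  · exact hp
  · exact this
  · exact Nat.mod_lt _ this
  · exact Nat.mod_lt _ this

/-- A uniform family of games that are played on the positions `(s, p, q)` with `s, p < N`. A move
depends on whether `s + 1 = N`, whether `p = 0`, the letter at position `p` of a word, the control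
state `q`, and the action; it may increase `s` by one, it changes `p` by a `Shift`, and it
changes `q`. -/
structure GridGame (A : Type) where
  M : ℕ
  k : ℕ
  owner : Fin (M + 1) → Fin 2
  win : Fin (M + 1) → Bool
  init : Fin (M + 1)
  move : Bool → Bool → Option A → Fin (M + 1) → Fin (k + 1) → Bool × Shift × Fin (M + 1)

namespace GridGame

variable {A : Type} (g : GridGame A) (w : List A) (N : ℕ)

def index (s p q : ℕ) : ℕ := (s * N + p) * (g.M + 1) + q

def rowOf (x : ℕ) : ℕ := x / (g.M + 1) / N

def colOf (x : ℕ) : ℕ := x / (g.M + 1) % N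

def ctlOf (x : ℕ) : Fin (g.M + 1) := Fin.ofNat (g.M + 1) x

def moveAt (s p : ℕ) (q : Fin (g.M + 1)) (a : Fin (g.k + 1)) : Bool × Shift × Fin (g.M + 1) :=
  g.move (decide (s + 1 = N)) (decide (p = 0)) w[p]? q a

/-- The index of the successor of the position `(s, p, q)`. -/
def succIndex (s p : ℕ) (q : Fin (g.M + 1)) (a : Fin (g.k + 1)) : ℕ :=
  g.index N ((s + (g.moveAt w N s p q a).1.toNat) % N) ((g.moveAt w N s p q a).2.1.apply N p)
    (g.moveAt w N s p q a).2.2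

/-- The game as an input of the decision problems. -/
def toInstance : Instance2 where
  m := N * N * (g.M + 1) - 1
  k := g.k
  arena :=
    { owner := fun x => g.owner (g.ctlOf x)
      init := Fin.ofNat _ g.init
      trans := fun x a => Fin.ofNat _ (g.succIndex w N (g.rowOf N x) (g.colOf N x) (g.ctlOf x) a) }
  target := fun i => Finset.univ.filter fun x => i = 0 → g.win (g.ctlOf x)

variable {N}

theorem index_lt {s p q : ℕ} (hs : s < N) (hp : p < N) (hq : q < g.M + 1) :
    g.index N s p q < N * N * (g.M + 1) := by
  have h1 : s * N + p < N * N := by nlinarith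
  unfold index
  nlinarith

/-- The bound in the form in which the number of states `m + 1` of `toInstance` unfolds. -/
theorem index_lt' {s p q : ℕ} (hs : s < N) (hp : p < N) (hq : q < g.M + 1) :
    g.index N s p q < N * N * (g.M + 1) - 1 + 1 := by
  have := g.index_lt hs hp hq
  omega

theorem rowOf_index {s p q : ℕ} (hp : p < N) (hq : q < g.M + 1) :
    g.rowOf N (g.index N s p q) = s := by
  have hN : 0 < N := by omega
  rw [rowOf, index, mul_comm _ (g.M + 1), Nat.mul_add_div (by omega), Nat.div_eq_of_lt hq,
    add_zero, mul_comm s, Nat.mul_add_div hN, Nat.div_eq_of_lt hp, add_zero]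

theorem colOf_index {s p q : ℕ} (hp : p < N) (hq : q < g.M + 1) :
    g.colOf N (g.index N s p q) = p := by
  rw [colOf, index, mul_comm _ (g.M + 1), Nat.mul_add_div (by omega), Nat.div_eq_of_lt hq,
    add_zero, mul_comm s, Nat.mul_add_mod, Nat.mod_eq_of_lt hp]

theorem ctlOf_index {s p : ℕ} (q : Fin (g.M + 1)) : g.ctlOf (g.index N s p q) = q := by
  ext
  simp [ctlOf, index, Nat.mod_eq_of_lt q.2]

theorem rowOf_lt {x : ℕ} (hN : 0 < N) (hx : x < N * N * (g.M + 1) - 1 + 1) : g.rowOf N x < N := by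
  have h : 0 < N * N * (g.M + 1) := by positivity
  rw [rowOf, Nat.div_div_eq_div_mul, Nat.div_lt_iff_lt_mul (by positivity)]
  calc x < N * N * (g.M + 1) := by omega
    _ = N * ((g.M + 1) * N) := by ring

theorem colOf_lt {x : ℕ} (hN : 0 < N) : g.colOf N x < N := Nat.mod_lt _ hN

theorem succIndex_lt {s p : ℕ} (hp : p < N) (q : Fin (g.M + 1)) (a : Fin (g.k + 1)) :
    g.succIndex w N s p q a < N * N * (g.M + 1) - 1 + 1 :=
  g.index_lt' (Nat.mod_lt _ (by omega)) (Shift.apply_lt _ hp) (Fin.is_lt _)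

theorem rowOf_succIndex {s p : ℕ} (hp : p < N) (q : Fin (g.M + 1)) (a : Fin (g.k + 1)) :
    g.rowOf N (g.succIndex w N s p q a) = (s + (g.moveAt w N s p q a).1.toNat) % N :=
  g.rowOf_index (Shift.apply_lt _ hp) (Fin.is_lt _)

theorem colOf_succIndex {s p : ℕ} (hp : p < N) (q : Fin (g.M + 1)) (a : Fin (g.k + 1)) :
    g.colOf N (g.succIndex w N s p q a) = (g.moveAt w N s p q a).2.1.apply N p :=
  g.colOf_index (Shift.apply_lt _ hp) (Fin.is_lt _)

theorem ctlOf_succIndex {s p : ℕ} (q : Fin (g.M + 1)) (a : Fin (g.k + 1)) :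
    g.ctlOf (g.succIndex w N s p q a) = (g.moveAt w N s p q a).2.2 :=
  g.ctlOf_index _

theorem trans_val (hN : 0 < N) (x : Fin ((g.toInstance w N).m + 1))
    (a : Fin ((g.toInstance w N).k + 1)) : ((g.toInstance w N).arena.trans x a : ℕ) =
      g.succIndex w N (g.rowOf N x) (g.colOf N x) (g.ctlOf x) a :=
  Nat.mod_eq_of_lt (g.succIndex_lt w (g.colOf_lt hN) _ _)

theorem init_val (hN : 0 < N) : ((g.toInstance w N).arena.init : ℕ) = g.init := by
  refine Nat.mod_eq_of_lt ?_
  have := g.index_lt' (N := N) hN hN g.init.2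
  simpa [index] using this

end GridGame

/-! ### The game that verifies a computation of a stack machine -/

namespace StackMachine

variable {C K Γ A : Type}

/-- Player 1 claims that the control state is `c`, or that some cell of stack `k`, counted from the
top, has content `o`. -/
abbrev Claim (C K Γ : Type) : Type := C ⊕ (K × Option Γ)

/-- Control states of the game: a claim, or the end of the game (`true` if Player 1 has won), or a
claim together with a control state and a symbol at the top of the selected stack one step earlier,
which Player 1 asserts in support of the claim. -/
abbrev GamePos (C K Γ : Type) : Type := (Claim C K Γ ⊕ Bool) ⊕ (Claim C K Γ × C × Option Γ)

/-- Both players share the actions: Player 1 uses the last two components as a guess, Player 2 uses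
the Boolean as a challenge, `true` attacking the guessed control state. -/
abbrev GameAct (C Γ : Type) : Type := Bool × C × Option Γ

variable (M : StackMachine C K Γ)

open Classical in
/-- What remains to be shown, one step earlier, for a claim at position `p`, if the control state
was `c` and the symbol at the top of the selected stack was `o`. -/
noncomputable def support (isZero : Bool) : Claim C K Γ → C → Option Γ → Shift × (Claim C K Γ ⊕ Bool)
  | .inl c', c, o =>
    if M.nxt c o = c' then (.zero, .inl (.inr (M.sel c, o))) else (.keep, .inr false)
  | .inr (k, o'), c, _ =>
    if k = M.sel c then
      match M.op c with
      | .keep => (.keep, .inl (.inr (k, o')))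
      | .pop => (.inc, .inl (.inr (k, o')))
      | .push γ =>
        if isZero then (.keep, .inr (decide (o' = some γ))) else (.dec, .inl (.inr (k, o')))
    else (.keep, .inl (.inr (k, o')))

open Classical in
/-- The truth of a claim in the initial configuration. -/
noncomputable def initially (c₀ : C) (k₀ : K) (letter : A → Γ) (a : Option A) : Claim C K Γ → Bool
  | .inl c => decide (c = c₀)
  | .inr (k, o) => decide (o = if k = k₀ then a.map letter else none)

/-- Rows count time backwards and advance only with a move of Player 2. In the last row, at time 0,
the claim is checked directly; the letter in column `p` is the initial content of cell `p` of stack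
`k₀`. -/
noncomputable def gameMove (c₀ : C) (k₀ : K) (letter : A → Γ) (isLast isZero : Bool) (a : Option A) :
    GamePos C K Γ → GameAct C Γ → Bool × Shift × GamePos C K Γ
  | .inl (.inl cl), (_, c, o) =>
    if isLast then (false, .keep, .inl (.inr (initially c₀ k₀ letter a cl)))
    else (false, .keep, .inr (cl, c, o))
  | .inl (.inr b), _ => (false, .keep, .inl (.inr b))
  | .inr (cl, c, o), (b, _, _) =>
    if b then (true, .keep, .inl (.inl (.inl c)))
    else (true, (M.support isZero cl c o).1, .inl (M.support isZero cl c o).2)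

/-- The truth of a claim about cell `p` at time `t` of a run. -/
def Holds (cfg : ℕ → Cfg C K Γ) (t p : ℕ) : Claim C K Γ ⊕ Bool → Prop
  | .inl (.inl c) => (cfg t).ctl = c
  | .inl (.inr (k, o)) => ((cfg t).stk k)[p]? = o
  | .inr b => b = true

/-- The positions that Player 1 wins. -/
def Good (N : ℕ) (cfg : ℕ → Cfg C K Γ) (t p : ℕ) : GamePos C K Γ → Prop
  | .inl v => Holds cfg t p v
  | .inr (cl, c, o) => (cfg (t - 1)).ctl = c ∧
      Holds cfg (t - 1) ((M.support (decide (p = 0)) cl c o).1.apply N p)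
        (M.support (decide (p = 0)) cl c o).2

theorem holds_ctl (cfg : ℕ → Cfg C K Γ) (t p : ℕ) (c : C) :
    Holds cfg t p (.inl (.inl c)) ↔ (cfg t).ctl = c := Iff.rfl

theorem holds_cell (cfg : ℕ → Cfg C K Γ) (t p : ℕ) (k : K) (o : Option Γ) :
    Holds cfg t p (.inl (.inr (k, o))) ↔ ((cfg t).stk k)[p]? = o := Iff.rfl

theorem holds_bool (cfg : ℕ → Cfg C K Γ) (t p : ℕ) (b : Bool) :
    Holds cfg t p (.inr b) ↔ b = true := Iff.rfl

/-- A true claim is supported by the actual control state and top symbol. Conversely the control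
state is unique, and a claim about the next control state is reduced to one about the top cell,
which pins down the symbol. The bound on `p` keeps the index shift of a pop from wrapping around. -/
theorem holds_succ_iff [DecidableEq K] (cfg : ℕ → Cfg C K Γ)
    (hcfg : ∀ t, cfg (t + 1) = M.step (cfg t)) {N t p : ℕ} (hp : p + 1 < N) (cl : Claim C K Γ) :
    Holds cfg (t + 1) p (.inl cl) ↔ ∃ c o, (cfg t).ctl = c ∧
      Holds cfg t ((M.support (decide (p = 0)) cl c o).1.apply N p)
        (M.support (decide (p = 0)) cl c o).2 := by
  rcases cl with c' | ⟨k, o'⟩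
  · rw [holds_ctl, hcfg]
    constructor
    · intro h
      refine ⟨(cfg t).ctl, ((cfg t).stk (M.sel (cfg t).ctl)).head?, rfl, ?_⟩
      rw [support, if_pos (show M.nxt _ _ = c' from h), holds_cell, List.head?_eq_getElem?]
      rfl
    · rintro ⟨c, o, rfl, h⟩
      rw [support] at h
      split_ifs at h with hc
      · rw [holds_cell] at h
        change M.nxt _ _ = c'
        rw [List.head?_eq_getElem?, ← hc, ← h]
        rfl
      · simp [holds_bool] at h
  -- For a cell, the support ignores `o` and `c` is forced, so the quantifiers disappear; `none` is
  -- a dummy symbol.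
  · have hex : (∃ c, ∃ o : Option Γ, (cfg t).ctl = c ∧
        Holds cfg t ((M.support (decide (p = 0)) (.inr (k, o')) c o).1.apply N p)
          (M.support (decide (p = 0)) (.inr (k, o')) c o).2) ↔
        Holds cfg t ((M.support (decide (p = 0)) (.inr (k, o')) (cfg t).ctl none).1.apply N p)
          (M.support (decide (p = 0)) (.inr (k, o')) (cfg t).ctl none).2 :=
      ⟨fun ⟨_, _, hc, h⟩ => by subst hc; exact h, fun h => ⟨_, none, rfl, h⟩⟩
    rw [hex, holds_cell, hcfg]
    by_cases hk : k = M.sel (cfg t).ctl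
    · subst hk
      simp only [step, support, if_true, Function.update_self]
      cases M.op (cfg t).ctl with
      | keep => exact Iff.rfl
      | pop => simp [StackOp.apply, Shift.apply, Nat.mod_eq_of_lt hp, holds_cell]
      -- The new top cell holds `γ`, which decides the claim at once; any deeper cell was one
      -- position higher before the push.
      | push γ =>
        cases p with
        | zero => simp [StackOp.apply, holds_bool, eq_comm]
        | succ p =>
          have : (p + 1 + N - 1) % N = p := by
            rw [show p + 1 + N - 1 = p + N by omega, Nat.add_mod_right]
            exact Nat.mod_eq_of_lt (by omega)
          simp only [StackOp.apply, Nat.succ_ne_zero, decide_false, Bool.false_eq_true, if_false,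
            holds_cell, Shift.apply, this, List.getElem?_cons_succ]
    · simp only [step, support, if_neg hk, Function.update_of_ne hk]
      exact Iff.rfl

theorem initially_eq_true_iff [DecidableEq K] {c₀ : C} {k₀ : K} {letter : A → Γ} (w : List A)
    {cfg : ℕ → Cfg C K Γ}
    (hcfg : cfg 0 = ⟨c₀, Function.update (fun _ => []) k₀ (w.map letter)⟩) (p : ℕ)
    (cl : Claim C K Γ) :
    initially c₀ k₀ letter w[p]? cl = true ↔ Holds cfg 0 p (.inl cl) := by
  rcases cl with c | ⟨k, o⟩
  · simp [initially, Holds, hcfg, eq_comm]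
  · by_cases hk : k = k₀
    · subst hk
      simp [initially, Holds, hcfg, eq_comm]
    · simp [initially, Holds, hcfg, hk, eq_comm]

variable {mm kk : ℕ}

/-- The verification game for the claim that the top of stack `k₁` is `yes` at the end. -/
noncomputable def game (eP : GamePos C K Γ ≃ Fin (mm + 1)) (eA : GameAct C Γ ≃ Fin (kk + 1)) (c₀ : C)
    (k₀ k₁ : K) (letter : A → Γ) (yes : Γ) : GridGame A where
  M := mm
  k := kk
  owner q := match eP.symm q with
    | .inl _ => 0
    | .inr _ => 1
  win q := match eP.symm q with
    | .inl (.inr b) => b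
    | _ => false
  init := eP (.inl (.inl (.inr (k₁, some yes))))
  move isLast isZero a q act :=
    let r := M.gameMove c₀ k₀ letter isLast isZero a (eP.symm q) (eA.symm act)
    (r.1, r.2.1, eP r.2.2)

variable (eP : GamePos C K Γ ≃ Fin (mm + 1)) (eA : GameAct C Γ ≃ Fin (kk + 1)) (c₀ : C)
    (k₀ k₁ : K) (letter : A → Γ) (yes : Γ)

/-- Handing a claim to Player 2 keeps `t` and lowers the rank by one; the answer lowers `t`, which
outweighs the return to a claim. -/
def rank (t : ℕ) : GamePos C K Γ → ℕ
  | .inl (.inl _) => 3 * t + 2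
  | .inl (.inr _) => 0
  | .inr _ => 3 * t + 1

/-- Reachable positions satisfy `p ≤ s`. -/
def Valid (N s p : ℕ) : GamePos C K Γ → Prop
  | .inl _ => p ≤ s
  | .inr _ => p ≤ s ∧ s + 1 < N

/-- The reachability criterion applied to the verification game, with time `N - 1 - R x`. The arena
enters only through the coordinates `R`, `P`, `Q` of its states, which keeps index arithmetic out of
the argument. -/
theorem hasDoomsdayEquilibrium_iff_good [DecidableEq K] [Nonempty C] {S Act : Type} [Nonempty Act]
    (G : Arena 2 S Act) {φ : Fin 2 → Set (ℕ → S)} {T : Set S} (hφ₁ : ∀ ρ, ρ ∈ φ 1)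
    (hφ₀ : ∀ ρ ∈ G.Plays, ρ ∈ φ 0 ↔ ∃ j, ρ j ∈ T) (w : List A) {N : ℕ} (cfg : ℕ → Cfg C K Γ)
    (hcfg₀ : cfg 0 = ⟨c₀, Function.update (fun _ => []) k₀ (w.map letter)⟩)
    (hcfg : ∀ t, cfg (t + 1) = M.step (cfg t)) (R P : S → ℕ) (Q : S → GamePos C K Γ)
    (act : Act → GameAct C Γ) (hact : Function.Surjective act)
    (mv : S → Act → Bool × Shift × GamePos C K Γ)
    (hmv : ∀ x a, mv x a = M.gameMove c₀ k₀ letter (decide (R x + 1 = N)) (decide (P x = 0)) w[P x]?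
      (Q x) (act a))
    (hRlt : ∀ x, R x < N)
    (hR : ∀ x a, R (G.trans x a) = (R x + (mv x a).1.toNat) % N)
    (hP : ∀ x a, P (G.trans x a) = (mv x a).2.1.apply N (P x))
    (hQ : ∀ x a, Q (G.trans x a) = (mv x a).2.2)
    (howner : ∀ x, G.owner x = match Q x with
      | .inl _ => 0
      | .inr _ => 1)
    (hT : ∀ x, x ∈ T ↔ Q x = .inl (.inr true)) (hR₀ : R G.init = 0) (hP₀ : P G.init = 0)
    {v : Claim C K Γ ⊕ Bool} (hQ₀ : Q G.init = .inl v) :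
    G.HasDoomsdayEquilibrium φ ↔ Holds cfg (N - 1) 0 v := by
  rw [G.hasDoomsdayEquilibrium_iff φ T hφ₁ hφ₀
    (fun x => Valid N (R x) (P x) (Q x)) (fun x => M.Good N cfg (N - 1 - R x) (P x) (Q x))
    (fun x => rank (N - 1 - R x) (Q x))]
  · rw [hR₀, hP₀, hQ₀]
    exact Iff.rfl
  · rw [hR₀, hP₀, hQ₀]
    exact le_rfl
  · intro x a hx
    rw [hR, hP, hQ, hmv]
    have hlt := hRlt x
    rcases hq : Q x with (cl | b) | ⟨cl, c, o⟩ <;> rw [hq] at hx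
    · simp only [Valid] at hx
      simp only [gameMove]
      split_ifs with h
      · simpa [Valid, Shift.apply, Nat.mod_eq_of_lt hlt] using hx
      · have : R x + 1 < N := by
          have := of_decide_eq_false (by simpa using h)
          omega
        simpa [Valid, Shift.apply, Nat.mod_eq_of_lt hlt, this] using hx
    · simpa [Valid, gameMove, Shift.apply, Nat.mod_eq_of_lt hlt] using hx
    · obtain ⟨hx, hlt'⟩ := hx
      simp only [gameMove]
      split_ifs with h
      · simp only [Valid, Shift.apply, Bool.toNat_true, Nat.mod_eq_of_lt hlt']
        omega
      · simp only [Valid, Bool.toNat_true, Nat.mod_eq_of_lt hlt']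
        -- The depth grows by at most one per row. Only a decrement at depth zero could break this
        -- by wrapping to `N - 1`, and `support` never requests one there.
        have hshift : ∀ d : Shift, (d = .dec → P x ≠ 0) → d.apply N (P x) ≤ R x + 1 := by
          intro d hd
          cases d with
          | keep => exact hx.trans (Nat.le_succ _)
          | zero => exact Nat.zero_le _
          | inc => exact (Nat.mod_le _ _).trans (by omega)
          | dec =>
            have := hd rfl
            rw [Shift.apply, show P x + N - 1 = (P x - 1) + N by omega, Nat.add_mod_right]
            exact (Nat.mod_le _ _).trans (by omega)
        refine hshift _ fun hd h0 => ?_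
        rw [h0] at hd
        rcases cl with c' | ⟨k, o'⟩
        · simp only [support] at hd
          split_ifs at hd
        · by_cases hk : k = M.sel c <;> cases hM : M.op c <;> simp [support, hk, hM] at hd
  · intro x _ hx
    rw [(hT x).1 hx]
    rfl
  · intro x hx hxT h0
    simp only [hR, hP, hQ, hmv]
    have hlt := hRlt x
    rw [howner] at h0
    rcases hq : Q x with (cl | b) | ⟨cl, c, o⟩ <;> rw [hq] at hx h0
    · simp only [gameMove]
      by_cases h : R x + 1 = N
      · have ht : N - 1 - R x = 0 := by omega
        simp only [h, decide_true, if_true, Bool.toNat_false, add_zero, Nat.mod_eq_of_lt hlt, ht,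
          Good, Shift.apply_keep, holds_bool, initially_eq_true_iff w hcfg₀, exists_const]
      -- Before the last row the time is positive, and `P x ≤ R x` leaves the room below `N` that
      -- `holds_succ_iff` needs.
      · obtain ⟨t, ht⟩ : ∃ t, N - 1 - R x = t + 1 := ⟨N - 1 - R x - 1, by omega⟩
        have hp : P x + 1 < N := by
          have : P x ≤ R x := hx
          omega
        simp only [h, decide_false, Bool.false_eq_true, if_false, Bool.toNat_false, add_zero,
          Nat.mod_eq_of_lt hlt, ht, Good, Shift.apply_keep, M.holds_succ_iff cfg hcfg hp,
          Nat.add_sub_cancel]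
        constructor
        · rintro ⟨c, o, h1, h2⟩
          -- The Boolean is irrelevant in a move of Player 1.
          obtain ⟨a, ha⟩ := hact (true, c, o)
          exact ⟨a, by rw [ha]; exact ⟨h1, h2⟩⟩
        · rintro ⟨a, h1, h2⟩
          exact ⟨_, _, h1, h2⟩
    -- Outside `T` a finished game is lost, and it stays so under all actions; both sides are false.
    · have hb : b = false := by
        rw [hT, hq] at hxT
        simpa using hxT
      simp [Good, gameMove, Holds, hb]
    · simp at h0
  · intro x hx hxT h0
    simp only [hR, hP, hQ, hmv]
    rw [howner] at h0
    rcases hq : Q x with (cl | b) | ⟨cl, c, o⟩ <;> rw [hq] at hx h0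
    · simp at h0
    · simp at h0
    · have ht : N - 1 - (R x + 1) = N - 1 - R x - 1 := by omega
      constructor
      · rintro ⟨h1, h2⟩ a
        rcases act a with ⟨_ | _, _, _⟩
        · simpa [gameMove, Good, Nat.mod_eq_of_lt hx.2, ht] using h2
        · simpa [gameMove, Good, Nat.mod_eq_of_lt hx.2, ht, holds_ctl] using h1
      · intro h
        -- The two challenges of Player 2 yield the two conjuncts of `Good`.
        obtain ⟨a, ha⟩ := hact (true, c, o)
        obtain ⟨b, hb⟩ := hact (false, c, o)
        have h1 := h a
        have h2 := h b
        rw [ha] at h1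
        rw [hb] at h2
        simp only [gameMove, Good, Bool.toNat_true, Nat.mod_eq_of_lt hx.2, ht, holds_ctl,
          if_true, Bool.false_eq_true, if_false] at h1 h2
        exact ⟨h1, h2⟩
  · intro x a hx hxT hgood
    simp only [hR, hQ, hmv]
    have hlt := hRlt x
    rcases hq : Q x with (cl | b) | ⟨cl, c, o⟩ <;> rw [hq] at hx hgood
    · simp only [gameMove]
      split_ifs <;> simp [rank, Nat.mod_eq_of_lt hlt]
    · have hb : b = false := by
        rw [hT, hq] at hxT
        simpa using hxT
      simp [Good, Holds, hb] at hgood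
    · have hlt' := hx.2
      have hle : ∀ v : Claim C K Γ ⊕ Bool, rank (N - 1 - (R x + 1)) (.inl v : GamePos C K Γ) <
          rank (N - 1 - R x) (.inr (cl, c, o)) := by
        rintro (v | b) <;> simp only [rank] <;> omega
      simp only [gameMove]
      split_ifs <;> simp only [Bool.toNat_true, Nat.mod_eq_of_lt hlt'] <;> exact hle _

theorem game_win_eq_true_iff (q : Fin (mm + 1)) :
    (M.game eP eA c₀ k₀ k₁ letter yes).win q = true ↔ eP.symm q = .inl (.inr true) := by
  change (match eP.symm q with
    | .inl (.inr b) => b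
    | _ => false) = true ↔ _
  generalize eP.symm q = q
  rcases q with (cl | b) | _ <;> simp

/-- The coordinates are decoded from the state index; the initial position is the claim, at time `N
- 1`, that cell 0 of stack `k₁` is `yes`. -/
theorem game_hasDoomsdayEquilibrium_iff [DecidableEq K] (w : List A) {N : ℕ} (hN : 0 < N)
    {φ : Fin 2 → Set (ℕ → Fin (((M.game eP eA c₀ k₀ k₁ letter yes).toInstance w N).m + 1))}
    (hφ₁ : ∀ ρ, ρ ∈ φ 1)
    (hφ₀ : ∀ ρ ∈ ((M.game eP eA c₀ k₀ k₁ letter yes).toInstance w N).arena.Plays, ρ ∈ φ 0 ↔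
      ∃ j, ρ j ∈ (((M.game eP eA c₀ k₀ k₁ letter yes).toInstance w N).target 0 : Set _)) :
    ((M.game eP eA c₀ k₀ k₁ letter yes).toInstance w N).arena.HasDoomsdayEquilibrium φ ↔
      ((M.step^[N - 1] ⟨c₀, Function.update (fun _ => []) k₀ (w.map letter)⟩).stk k₁)[0]? =
        some yes := by
  let g := M.game eP eA c₀ k₀ k₁ letter yes
  have : Nonempty C := ⟨c₀⟩
  have h0 : ((g.toInstance w N).arena.init : ℕ) = g.index N 0 0 g.init := by
    rw [g.init_val w hN]
    simp [GridGame.index]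
  refine M.hasDoomsdayEquilibrium_iff_good c₀ k₀ letter _ hφ₁ hφ₀ w
    (fun t => M.step^[t] ⟨c₀, Function.update (fun _ => []) k₀ (w.map letter)⟩) rfl
    (fun t => Function.iterate_succ_apply' _ _ _) (fun x => g.rowOf N x) (fun x => g.colOf N x)
    (fun x => eP.symm (g.ctlOf x)) (fun a => eA.symm a) eA.symm.surjective _ (fun x a => rfl)
    (fun x => g.rowOf_lt hN x.2)
    (fun x a => (congrArg (g.rowOf N) (g.trans_val w hN x a)).trans
      (g.rowOf_succIndex w (g.colOf_lt hN) _ _))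
    (fun x a => (congrArg (g.colOf N) (g.trans_val w hN x a)).trans
      (g.colOf_succIndex w (g.colOf_lt hN) _ _))
    (fun x a => ?_) (fun x => rfl) (fun x => ?_)
    ((congrArg (g.rowOf N) h0).trans (g.rowOf_index hN g.init.2))
    ((congrArg (g.colOf N) h0).trans (g.colOf_index hN g.init.2)) (v := .inl (.inr (k₁, some yes))) ?_
  · exact (congrArg eP.symm ((congrArg g.ctlOf (g.trans_val w hN x a)).trans
      (g.ctlOf_succIndex w _ _))).trans (eP.symm_apply_apply _)
  · have h1 : x ∈ ((g.toInstance w N).target 0 : Set _) ↔ g.win (g.ctlOf x) = true :=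
      Finset.mem_coe.trans (Finset.mem_filter_univ _ |>.trans ⟨fun h => h rfl, fun h _ => h⟩)
    exact h1.trans (M.game_win_eq_true_iff eP eA c₀ k₀ k₁ letter yes _)
  · exact (congrArg eP.symm ((congrArg g.ctlOf h0).trans (g.ctlOf_index _))).trans
      (eP.symm_apply_apply _)

end StackMachine

/-! ### Sweep machines -/

/-- A machine whose memory is a list of cells. In each step it sweeps once over the memory, from the
first to the last cell, with a bit that is `true` at the beginning; then, depending on the final
bit and on the scanned input symbol, it halts or changes its state, moves the input head, writes
output and possibly appends a cell to the memory. -/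
structure SweepMachine (A B : Type) where
  Q : Type
  Cell : Type
  [finiteQ : Finite Q]
  [finiteCell : Finite Cell]
  start : Q
  cell : Q → Bool → Cell → Cell × Bool
  finish : Q → Bool → InSym A → Option (Q × Move × List B × Option Cell)

/-- The effect of a sweep on a list of cells. -/
def sweep {Cell : Type} (f : Bool → Cell → Cell × Bool) : Bool → List Cell → List Cell × Bool
  | b, [] => ([], b)
  | b, c :: l => ((f b c).1 :: (sweep f (f b c).2 l).1, (sweep f (f b c).2 l).2)

theorem length_sweep {Cell : Type} (f : Bool → Cell → Cell × Bool) (b : Bool) (l : List Cell) :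
    (sweep f b l).1.length = l.length := by
  induction l generalizing b with
  | nil => rfl
  | cons c l ih => simp [sweep, ih]

namespace SweepMachine

variable {A B : Type} (M : SweepMachine A B)

structure Config (M : SweepMachine A B) where
  state : M.Q
  mem : List M.Cell
  inPos : ℕ
  out : List B

def initial : M.Config := ⟨M.start, [], 0, []⟩

def step (w : List A) (c : M.Config) : Option M.Config :=
  match M.finish c.state (sweep (M.cell c.state) true c.mem).2
      (Transducer.inputSymbol w c.inPos) with
  | none => none
  | some (q, d, o, a) =>
    some ⟨q, (sweep (M.cell c.state) true c.mem).1 ++ a.toList,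
      min (d.apply c.inPos) (w.length + 1), c.out ++ o⟩

/-- `d` is reached from `c` on input `w`, with at most `S` cells. -/
def Reaches (w : List A) (S : ℕ) : M.Config → M.Config → Prop :=
  Relation.ReflTransGen fun c d => M.step w c = some d ∧ d.mem.length ≤ S

theorem Reaches.trans {M : SweepMachine A B} {w : List A} {S : ℕ} {c d e : M.Config}
    (h₁ : M.Reaches w S c d) (h₂ : M.Reaches w S d e) : M.Reaches w S c e :=
  Relation.ReflTransGen.trans h₁ h₂

/-- The simulation of a sweep machine by a transducer with one work tape. The first cell of the tape
carries a mark; the state `inl (q, b)` is used in sweeps, the state `inr q` when the head returns to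
the mark. -/
def toTransducer : Transducer A B where
  Q := Option ((M.Q × Bool) ⊕ M.Q)
  K := Unit
  Γ := Option (Option M.Cell)
  finiteQ :=
    have := M.finiteQ
    inferInstance
  finiteΓ :=
    have := M.finiteCell
    inferInstance
  start := none
  blank := none
  δ
    | none, _, _ => some (some (.inl (M.start, true)), .stay, fun _ => (some none, .right), [])
    | some (.inl (q, b)), s, x =>
      match x () with
      | some (some c) =>
        some (some (.inl (q, (M.cell q b c).2)), .stay,
          fun _ => (some (some (M.cell q b c).1), .right), [])
      | _ =>
        match M.finish q b s with
        | none => none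
        | some (q', d, o, a) => some (some (.inr q'), d, fun _ => (a.map some, .left), o)
    | some (.inr q), _, x =>
      match x () with
      | some none => some (some (.inl (q, true)), .stay, fun _ => (some none, .right), [])
      | y => some (some (.inr q), .stay, fun _ => (y, .left), [])

/-- The tape that represents a list of cells. -/
def tapeOf {Cell : Type} (l : List Cell) : ℕ → Option (Option Cell)
  | 0 => some none
  | j + 1 => l[j]?.map some

theorem update_tapeOf_cons {Cell : Type} (l l' : List Cell) (c c' : Cell) :
    Function.update (tapeOf (l ++ c :: l')) (l.length + 1) (some (some c')) =
      tapeOf (l ++ c' :: l') := by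
  funext j
  cases j with
  | zero => simp [tapeOf]
  | succ j =>
    rcases lt_trichotomy j l.length with h | h | h
    · simp [tapeOf, h.ne, List.getElem?_append_left h]
    · simp [tapeOf, h]
    · obtain ⟨i, hi⟩ : ∃ i, j - l.length = i + 1 := ⟨j - l.length - 1, by omega⟩
      simp [tapeOf, h.ne', List.getElem?_append_right h.le, hi]

/-- As blank is `none`, a single write behind the last cell covers both cases, appending a cell or
not. -/
theorem update_tapeOf_end {Cell : Type} (l : List Cell) (a : Option Cell) :
    Function.update (tapeOf l) (l.length + 1) (a.map some) = tapeOf (l ++ a.toList) := by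
  funext j
  cases j with
  | zero => simp [tapeOf]
  | succ j =>
    rcases lt_trichotomy j l.length with h | h | h
    · simp [tapeOf, h.ne, List.getElem?_append_left h]
    · cases a <;> simp [tapeOf, h]
    · obtain ⟨i, hi⟩ : ∃ i, j - l.length = i + 1 := ⟨j - l.length - 1, by omega⟩
      cases a <;> simp [tapeOf, h.ne', h.le, h]

theorem tapeOf_nil {Cell : Type} :
    Function.update (fun _ : ℕ => (none : Option (Option Cell))) 0 (some none) = tapeOf [] := by
  funext j
  cases j <;> simp [tapeOf]

def config (st : M.toTransducer.Q) (i p : ℕ) (l : List M.Cell) (out : List B) :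
    M.toTransducer.Config :=
  ⟨st, i, fun _ => p, fun _ => tapeOf l, out⟩

end SweepMachine

/-! ### Simulation of sweep machines by transducers -/

/-- `d` is reached from `c` on input `w`, with heads in the first `S` cells. -/
def Transducer.Reaches {A B : Type} (M : Transducer A B) (w : List A) (S : ℕ) :
    M.Config → M.Config → Prop :=
  Relation.ReflTransGen fun c d => M.next w c = d ∧ ∀ k, d.pos k < S

theorem Transducer.Reaches.exists_iterate {A B : Type} {M : Transducer A B} {w : List A} {S : ℕ}
    {c d : M.Config} (h : M.Reaches w S c d) (hc : ∀ k, c.pos k < S) :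
    ∃ t, (M.next w)^[t] c = d ∧ ∀ i ≤ t, ∀ k, ((M.next w)^[i] c).pos k < S := by
  induction h with
  | refl =>
    refine ⟨0, rfl, fun i hi k => ?_⟩
    obtain rfl : i = 0 := by omega
    exact hc k
  | @tail _ e _ hd ih =>
    obtain ⟨t, ht, hpos⟩ := ih
    have hs : (M.next w)^[t + 1] c = e := by
      rw [Function.iterate_succ_apply', ht]
      exact hd.1
    refine ⟨t + 1, hs, fun i hi k => ?_⟩
    rcases Nat.le_succ_iff.1 hi with h | rfl
    · exact hpos i h k
    · rw [hs]
      exact hd.2 k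

/-- A halted configuration is fixed, so the space bound along a halting run extends to all times. -/
theorem Transducer.computesInLogSpace_of_reaches {A B : Type} {M : Transducer A B}
    {f : List A → List B} (m : ℕ) (h : ∀ w, ∃ d, M.Reaches w (m * (Nat.log 2 w.length + 1)) M.initial d ∧
      M.Halted w d ∧ d.out = f w) (hm : 0 < m) : M.ComputesInLogSpace f := by
  refine ⟨m, fun w => ?_⟩
  obtain ⟨d, hd, hhalt, hout⟩ := h w
  obtain ⟨t, ht, hpos⟩ := hd.exists_iterate fun k => by
    change 0 < _
    positivity
  have hfix : M.next w d = d := by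
    have : M.action w d = none := hhalt
    simp [next, this]
  refine ⟨⟨t, by rw [run, ht]; exact hhalt, by rw [run, ht]; exact hout⟩, fun i k => ?_⟩
  rcases le_total i t with hi | hi
  · exact hpos i hi k
  · rw [run, ← Nat.sub_add_cancel hi, Function.iterate_add_apply, ht, Function.iterate_fixed hfix, ← ht]
    exact hpos t le_rfl k

namespace SweepMachine

variable {A B : Type} (M : SweepMachine A B) {w : List A} {S : ℕ}

/-- The invariant of a sweep in progress: `l` is already rewritten and `l'` is still to come.
Positions are shifted by one because of the mark in cell 0. -/
theorem reaches_sweep (q : M.Q) (b : Bool) {i : ℕ} (hi : i ≤ w.length + 1) (l l' : List M.Cell)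
    (out : List B) (hS : l.length + l'.length + 1 < S) :
    M.toTransducer.Reaches w S
      (M.config (some (.inl (q, b))) i (l.length + 1) (l ++ l') out)
      (M.config (some (.inl (q, (sweep (M.cell q) b l').2))) i (l.length + l'.length + 1)
        (l ++ (sweep (M.cell q) b l').1) out) := by
  induction l' generalizing l b with
  | nil => exact .refl
  | cons c l' ih =>
    have h := ih (M.cell q b c).2 (l ++ [(M.cell q b c).1]) (by simp at hS ⊢; omega)
    simp only [List.length_append, List.length_singleton, List.append_assoc,
      List.singleton_append] at h
    rw [show l.length + 1 + l'.length = l.length + (c :: l').length by simp; omega] at h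
    refine .head ⟨?_, fun _ => ?_⟩ h
    · have ht : tapeOf (l ++ c :: l') (l.length + 1) = some (some c) := by simp [tapeOf]
      simp only [Transducer.next, Transducer.action, toTransducer, config, ht, Move.apply,
        update_tapeOf_cons, List.append_nil, min_eq_left hi]
    · change l.length + 1 + 1 < S
      simp at hS
      omega

theorem reaches_rewind (q : M.Q) {i : ℕ} (hi : i ≤ w.length + 1) (l : List M.Cell)
    (out : List B) (p : ℕ) (hp : p ≤ l.length) (hS : l.length + 1 < S) :
    M.toTransducer.Reaches w S
      (M.config (some (.inr q)) i p l out) (M.config (some (.inl (q, true))) i 1 l out) := by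
  induction p with
  | zero =>
    refine .single ⟨?_, fun _ => ?_⟩
    · have ht : tapeOf l 0 = some none := rfl
      have hu : Function.update (tapeOf l) 0 (some none) = tapeOf l := Function.update_eq_self 0 (tapeOf l)
      simp only [Transducer.next, Transducer.action, toTransducer, config, ht, Move.apply, hu,
        List.append_nil, min_eq_left hi]
    · change 1 < S
      omega
  | succ p ih =>
    refine .head ⟨?_, fun _ => ?_⟩ (ih (by omega))
    · have ht : tapeOf l (p + 1) = some (some l[p]) := by simp [tapeOf, List.getElem?_eq_getElem hp]
      have hu : Function.update (tapeOf l) (p + 1) (some (some l[p])) = tapeOf l := by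
        rw [← ht, Function.update_eq_self]
      simp only [Transducer.next, Transducer.action, toTransducer, config, ht, Move.apply, hu,
        List.append_nil, min_eq_left hi, Nat.add_sub_cancel]
    · change p < S
      omega

theorem tapeOf_length {Cell : Type} (l : List Cell) : tapeOf l (l.length + 1) = none := by
  simp [tapeOf]

/-- A step is simulated by a sweep up to the blank behind the memory, one move there according to
`finish`, and a return to the mark. -/
theorem reaches_of_step {c d : M.Config} (h : M.step w c = some d) (hi : c.inPos ≤ w.length + 1)
    (hS : d.mem.length + 1 < S) :
    M.toTransducer.Reaches w S (M.config (some (.inl (c.state, true))) c.inPos 1 c.mem c.out)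
      (M.config (some (.inl (d.state, true))) d.inPos 1 d.mem d.out) ∧ d.inPos ≤ w.length + 1 := by
  rw [step] at h
  split at h
  · cases h
  · rename_i q mv o a hf
    cases h
    have hlen := length_sweep (M.cell c.state) true c.mem
    simp only [List.length_append, hlen] at hS
    refine ⟨?_, min_le_right _ _⟩
    refine (M.reaches_sweep c.state true hi [] c.mem c.out (by simp; omega)).trans ?_
    refine .head ⟨?_, fun _ => ?_⟩ (M.reaches_rewind q (min_le_right _ _) _ _ c.mem.length
      (by simp [hlen]) (by simpa [hlen] using hS))
    · have ht := tapeOf_length (sweep (M.cell c.state) true c.mem).1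
      have hu := update_tapeOf_end (sweep (M.cell c.state) true c.mem).1 a
      rw [hlen] at ht hu
      simp only [Transducer.next, Transducer.action, toTransducer, config, List.length_nil,
        List.nil_append, zero_add, ht, hf, hu, Move.apply, Nat.add_sub_cancel]
    · change c.mem.length < S
      omega

theorem reaches_of_reaches {L : ℕ} {c d : M.Config} (h : M.Reaches w L c d)
    (hi : c.inPos ≤ w.length + 1) (hS : L + 1 < S) :
    M.toTransducer.Reaches w S (M.config (some (.inl (c.state, true))) c.inPos 1 c.mem c.out)
      (M.config (some (.inl (d.state, true))) d.inPos 1 d.mem d.out) ∧ d.inPos ≤ w.length + 1 := by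
  induction h with
  | refl => exact ⟨.refl, hi⟩
  | tail _ hd ih =>
    have := M.reaches_of_step hd.1 ih.2 (lt_of_le_of_lt (Nat.succ_le_succ hd.2) hS)
    exact ⟨ih.1.trans this.1, this.2⟩

theorem Reaches.length_le {L : ℕ} {c d : M.Config} (h : M.Reaches w L c d) (hc : c.mem.length ≤ L) :
    d.mem.length ≤ L := by
  induction h with
  | refl => exact hc
  | tail _ hd _ => exact hd.2

/-- A function that is computed by a sweep machine with a memory of logarithmic length is computable
in logarithmic space. -/
theorem logSpaceComputable {f : List A → List B}
    (h : ∀ w, ∃ d, M.Reaches w (Nat.log 2 w.length + 1) M.initial d ∧ M.step w d = none ∧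
      d.out = f w) : LogSpaceComputable f := by
  refine ⟨M.toTransducer, Transducer.computesInLogSpace_of_reaches 3 (fun w => ?_) (by norm_num)⟩
  obtain ⟨d, hd, hhalt, hout⟩ := h w
  have hlen := Reaches.length_le M hd (Nat.zero_le _)
  -- The head also visits the mark and the blank behind the memory. For a memory of one cell the
  -- factor 2 would be too small.
  have hS : Nat.log 2 w.length + 1 + 1 < 3 * (Nat.log 2 w.length + 1) := by omega
  have h1 := M.reaches_of_reaches hd (Nat.zero_le _) hS
  refine ⟨M.config (some (.inl (d.state, (sweep (M.cell d.state) true d.mem).2))) d.inPos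
    (d.mem.length + 1) (sweep (M.cell d.state) true d.mem).1 d.out, ?_, ?_, hout⟩
  · refine .head (b := M.config (some (.inl (M.start, true))) 0 1 [] []) ⟨?_, fun _ => ?_⟩
      (h1.1.trans ?_)
    · have hu := tapeOf_nil (Cell := M.Cell)
      simp only [Transducer.next, Transducer.action, toTransducer, config, Transducer.initial,
        Move.apply, hu, List.append_nil, zero_add, Nat.zero_min]
    · change 1 < _
      omega
    · have := M.reaches_sweep (S := 3 * (Nat.log 2 w.length + 1)) d.state true h1.2 [] d.mem d.out
        (by simp; omega)
      simp only [List.length_nil, List.nil_append, zero_add] at this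
      exact this
  · have ht := tapeOf_length (sweep (M.cell d.state) true d.mem).1
    rw [length_sweep] at ht
    have hf : M.finish d.state (sweep (M.cell d.state) true d.mem).2
        (Transducer.inputSymbol w d.inPos) = none := by
      rw [step] at hhalt
      split at hhalt
      · assumption
      · cases hhalt
    simp only [Transducer.Halted, Transducer.action, toTransducer, config, ht, hf]

end SweepMachine


/-! ### Registers -/

section Registers

/-- A change of a digit with carry or borrow. -/
def Shift.digit {β : ℕ} : Shift → Bool → Fin (β + 2) → Fin (β + 2) × Bool
  | .keep, b, d => (d, b)
  | .zero, b, _ => (0, b)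
  | .inc, true, d => (d + 1, decide (d = Fin.last _))
  | .dec, true, d => (d - 1, decide (d = 0))
  | _, false, d => (d, false)

/-- The list of the first `l` digits of four numbers in base `β + 2`, least significant first. -/
def regs (β : ℕ) : ℕ → (Fin 4 → ℕ) → List (Fin 4 → Fin (β + 2))
  | 0, _ => []
  | l + 1, v => (fun r => Fin.ofNat _ (v r)) :: regs β l fun r => v r / (β + 2)

theorem length_regs (β l : ℕ) (v : Fin 4 → ℕ) : (regs β l v).length = l := by
  induction l generalizing v with
  | zero => rfl
  | succ l ih => simp [regs, ih]

theorem regs_zero (β l : ℕ) : regs β l (fun _ => 0) = List.replicate l 0 := by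
  induction l with
  | zero => rfl
  | succ l ih =>
    simp only [regs, Nat.zero_div, ih, List.replicate_succ]
    rfl

/-- Register `dst` gets the value of register `src`, changed by `d`. -/
def cellOp {β : ℕ} (dst src : Fin 4) (d : Shift) (b : Bool) (c : Fin 4 → Fin (β + 2)) :
    (Fin 4 → Fin (β + 2)) × Bool :=
  (Function.update c dst (d.digit b (c src)).1, (d.digit b (c src)).2)

/-- The final carry or borrow. -/
def Shift.flag (N : ℕ) : Shift → ℕ → Bool
  | .inc, x => decide (x + 1 = N)
  | .dec, x => decide (x = 0)
  | _, _ => true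

/-- The effect of an operation on the remaining digits, given the carry or borrow. -/
def Shift.applyCarry (N : ℕ) : Shift → Bool → ℕ → ℕ × Bool
  | .keep, b, x => (x, b)
  | .zero, b, _ => (0, b)
  | d, true, x => (d.apply N x, d.flag N x)
  | _, false, x => (x, false)

theorem Shift.applyCarry_true (N : ℕ) (d : Shift) (x : ℕ) :
    d.applyCarry N true x = (d.apply N x, d.flag N x) := by
  cases d <;> rfl

/-- Schoolbook arithmetic: treat the lowest digit, then pass the carry or borrow on to the quotient.
This is the induction step of `sweep_cellOp_aux`. -/
theorem Shift.applyCarry_mul {β N : ℕ} (d : Shift) (b : Bool) {x : ℕ} (hx : x < N * (β + 2)) :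
    Fin.ofNat (β + 2) (d.applyCarry (N * (β + 2)) b x).1 = (d.digit b (Fin.ofNat (β + 2) x)).1 ∧
      (d.applyCarry (N * (β + 2)) b x).1 / (β + 2) =
        (d.applyCarry N (d.digit b (Fin.ofNat (β + 2) x)).2 (x / (β + 2))).1 ∧
      (d.applyCarry (N * (β + 2)) b x).2 =
        (d.applyCarry N (d.digit b (Fin.ofNat (β + 2) x)).2 (x / (β + 2))).2 := by
  have hN : 0 < N := Nat.pos_of_mul_pos_right (lt_of_le_of_lt (Nat.zero_le _) hx)
  have hy : x / (β + 2) < N := Nat.div_lt_of_lt_mul (by rwa [mul_comm])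
  have hB : 0 < β + 2 := by omega
  have hdm := Nat.div_add_mod x (β + 2)
  have hlt := Nat.mod_lt x hB
  cases b with
  | false =>
    cases d with
    | zero => exact ⟨rfl, Nat.zero_div _, rfl⟩
    | _ => exact ⟨rfl, rfl, rfl⟩
  | true =>
    cases d with
    | keep => exact ⟨rfl, rfl, rfl⟩
    | zero => exact ⟨rfl, Nat.zero_div _, rfl⟩
    | inc =>
      have h1 : Fin.ofNat (β + 2) ((x + 1) % (N * (β + 2))) = Fin.ofNat (β + 2) x + 1 := by
        ext
        simp [Fin.val_add]
      have hlast : Fin.ofNat (β + 2) x = Fin.last (β + 1) ↔ x % (β + 2) = β + 1 := by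
        rw [Fin.ext_iff]
        rfl
      refine ⟨h1, ?_⟩
      change (x + 1) % (N * (β + 2)) / (β + 2) =
        (Shift.inc.applyCarry N (decide (Fin.ofNat (β + 2) x = Fin.last (β + 1))) _).1 ∧
        decide (x + 1 = N * (β + 2)) =
        (Shift.inc.applyCarry N (decide (Fin.ofNat (β + 2) x = Fin.last (β + 1))) _).2
      simp only [hlast, Nat.mod_mul_left_div_self]
      -- A carry leaves the lowest digit exactly when that digit is maximal.
      by_cases hd : x % (β + 2) = β + 1
      · have hx1 : x + 1 = (x / (β + 2) + 1) * (β + 2) := by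
          rw [hd] at hdm
          linarith
        have hq : (x + 1) / (β + 2) = x / (β + 2) + 1 := by
          rw [hx1, Nat.mul_div_cancel _ hB]
        simp only [hd, decide_true, applyCarry_true, hq, apply, flag, true_and, decide_eq_decide]
        rw [hx1, Nat.mul_left_inj hB.ne']
      · have hq : (x + 1) / (β + 2) = x / (β + 2) := by
          rw [show x + 1 = x % (β + 2) + 1 + (β + 2) * (x / (β + 2)) by linarith,
            Nat.add_mul_div_left _ _ hB, Nat.div_eq_of_lt (by omega), zero_add]
        simp only [hd, decide_false, applyCarry, hq, Nat.mod_eq_of_lt hy, true_and,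
          decide_eq_false_iff_not]
        intro h
        have : (x + 1) / (β + 2) = N := by rw [h, Nat.mul_div_cancel _ hB]
        omega
    | dec =>
      obtain ⟨K, hK⟩ : ∃ K, N * (β + 2) = K + 1 := ⟨N * (β + 2) - 1, by
        have := Nat.mul_pos hN hB
        omega⟩
      have h1 : Fin.ofNat (β + 2) ((x + N * (β + 2) - 1) % (N * (β + 2))) =
          Fin.ofNat (β + 2) x - 1 := by
        rw [eq_sub_iff_add_eq]
        ext
        simp only [Fin.val_add, Fin.val_ofNat, Fin.val_one, Nat.mod_mod_of_dvd _ (Nat.dvd_mul_left _ _)]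
        rw [Nat.mod_add_mod, show x + N * (β + 2) - 1 + 1 = x + N * (β + 2) by omega,
          Nat.add_mul_mod_self_right]
      have hzero : Fin.ofNat (β + 2) x = 0 ↔ x % (β + 2) = 0 := by
        rw [Fin.ext_iff]
        rfl
      refine ⟨h1, ?_⟩
      change (x + N * (β + 2) - 1) % (N * (β + 2)) / (β + 2) =
        (Shift.dec.applyCarry N (decide (Fin.ofNat (β + 2) x = 0)) _).1 ∧
        decide (x = 0) = (Shift.dec.applyCarry N (decide (Fin.ofNat (β + 2) x = 0)) _).2
      simp only [hzero, Nat.mod_mul_left_div_self]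
      obtain ⟨n, rfl⟩ : ∃ n, N = n + 1 := ⟨N - 1, by omega⟩
      -- A borrow is needed exactly when the lowest digit is zero.
      by_cases hd : x % (β + 2) = 0
      · have hq : (x + (n + 1) * (β + 2) - 1) / (β + 2) = x / (β + 2) + (n + 1) - 1 := by
          rw [hd] at hdm
          have h : x + (n + 1) * (β + 2) = β + 1 + (β + 2) * (x / (β + 2) + n) + 1 := by linarith
          rw [h, Nat.add_sub_cancel, Nat.add_mul_div_left _ _ hB, Nat.div_eq_of_lt (by omega), zero_add]
          rfl
        simp only [hd, decide_true, applyCarry_true, hq, apply, flag, true_and, decide_eq_decide]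
        constructor
        · rintro rfl
          exact Nat.zero_div _
        · intro h
          rw [h, hd] at hdm
          omega
      · have hq : (x + (n + 1) * (β + 2) - 1) / (β + 2) = x / (β + 2) + (n + 1) := by
          obtain ⟨d, hd'⟩ : ∃ d, x % (β + 2) = d + 1 := ⟨x % (β + 2) - 1, by omega⟩
          have h : x + (n + 1) * (β + 2) = d + (β + 2) * (x / (β + 2) + (n + 1)) + 1 := by
            linarith
          rw [h, Nat.add_sub_cancel, Nat.add_mul_div_left _ _ hB, Nat.div_eq_of_lt (by omega), zero_add]
        simp only [hd, decide_false, applyCarry, hq, Nat.add_mod_right, Nat.mod_eq_of_lt hy, true_and,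
          decide_eq_false_iff_not]
        rintro rfl
        exact hd (Nat.zero_mod _)

theorem sweep_cellOp_aux (β l : ℕ) (dst src : Fin 4) (d : Shift) (b : Bool) (v : Fin 4 → ℕ)
    (h : v src < (β + 2) ^ l) :
    sweep (cellOp dst src d) b (regs β l v) =
      (regs β l (Function.update v dst (d.applyCarry ((β + 2) ^ l) b (v src)).1),
        (d.applyCarry ((β + 2) ^ l) b (v src)).2) := by
  induction l generalizing b v with
  | zero =>
    have : v src = 0 := by simpa using h
    cases d <;> cases b <;> simp [sweep, regs, Shift.applyCarry, Shift.flag, this]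
  | succ l ih =>
    rw [pow_succ] at h ⊢
    obtain ⟨h1, h2, h3⟩ := Shift.applyCarry_mul d b h
    have ih' := ih (cellOp dst src d b fun r => Fin.ofNat (β + 2) (v r)).2 (fun r => v r / (β + 2))
      (Nat.div_lt_of_lt_mul (by rwa [mul_comm]))
    simp only [sweep, regs, ih', h3]
    refine Prod.ext (List.cons_eq_cons.2 ⟨?_, ?_⟩) rfl
    · funext r
      by_cases hr : r = dst
      · subst hr
        simp only [cellOp, Function.update_self]
        exact h1.symm
      · simp [cellOp, hr]
    · congr 1
      funext r
      by_cases hr : r = dst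
      · subst hr
        simp [cellOp, h2]
      · simp [hr]

/-- The initial bit `true` is the unit to be added or subtracted; the final bit reports wraparound
and so serves as a test for the largest value or for zero. -/
theorem sweep_cellOp (β l : ℕ) (dst src : Fin 4) (d : Shift) (v : Fin 4 → ℕ)
    (h : v src < (β + 2) ^ l) :
    sweep (cellOp dst src d) true (regs β l v) =
      (regs β l (Function.update v dst (d.apply ((β + 2) ^ l) (v src))),
        d.flag ((β + 2) ^ l) (v src)) := by
  rw [sweep_cellOp_aux β l dst src d true v h, Shift.applyCarry_true]

theorem update_reg₀ {s p y x a b : ℕ} (h : a = b) :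
    Function.update ![s, p, y, x] 0 a = ![b, p, y, x] := by
  subst h
  funext i
  fin_cases i <;> rfl

theorem update_reg₁ {s p y x a b : ℕ} (h : a = b) :
    Function.update ![s, p, y, x] 1 a = ![s, b, y, x] := by
  subst h
  funext i
  fin_cases i <;> rfl

theorem update_reg₂ {s p y x a b : ℕ} (h : a = b) :
    Function.update ![s, p, y, x] 2 a = ![s, p, b, x] := by
  subst h
  funext i
  fin_cases i <;> rfl

theorem update_reg₃ {s p y x a b : ℕ} (h : a = b) :
    Function.update ![s, p, y, x] 3 a = ![s, p, y, b] := by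
  subst h
  funext i
  fin_cases i <;> rfl

theorem sweep_id {Cell : Type} (b : Bool) (l : List Cell) :
    sweep (fun b c => (c, b)) b l = (l, b) := by
  induction l with
  | nil => rfl
  | cons c l ih => simp [sweep, ih]

theorem sweep_const {Cell : Type} (z : Cell) (b : Bool) (l : List Cell) :
    sweep (fun b _ => (z, b)) b l = (List.replicate l.length z, b) := by
  induction l with
  | nil => rfl
  | cons c l ih => simp [sweep, ih, List.replicate_succ]

end Registers

/-! ### Binary counting -/

section BinaryCounter

variable {β : ℕ}

/-- Increment of a binary number whose bits `0` and `1` are constant cells. -/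
def binaryInc (b : Bool) (c : Fin 4 → Fin (β + 2)) : (Fin 4 → Fin (β + 2)) × Bool :=
  if b then if c = 0 then (1, false) else (0, true) else (c, false)

theorem one_ne_zero_cell : (1 : Fin 4 → Fin (β + 2)) ≠ 0 := fun h => by
  simpa using congrFun h 0

def binaryValue : List (Fin 4 → Fin (β + 2)) → ℕ
  | [] => 0
  | c :: l => (if c = 0 then 0 else 1) + 2 * binaryValue l

/-- The memory after counting up to `n`, where a cell is appended on overflow. -/
def counter (β : ℕ) : ℕ → List (Fin 4 → Fin (β + 2))
  | 0 => [0]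
  | n + 1 => (sweep binaryInc true (counter β n)).1 ++
      (if (sweep binaryInc true (counter β n)).2 then some 1 else none).toList

theorem binaryValue_lt (l : List (Fin 4 → Fin (β + 2))) : binaryValue l < 2 ^ l.length := by
  induction l with
  | nil => simp [binaryValue]
  | cons c l ih =>
    simp only [binaryValue, List.length_cons, pow_succ]
    split_ifs <;> omega

theorem binaryValue_append (l : List (Fin 4 → Fin (β + 2))) :
    binaryValue (l ++ [1]) = binaryValue l + 2 ^ l.length := by
  induction l with
  | nil => simp [binaryValue, one_ne_zero_cell]
  | cons c l ih =>
    simp only [List.cons_append, binaryValue, List.length_cons, pow_succ, ih]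
    ring

/-- Conservation of value: an overflow bit weighs `2 ^ l.length`. -/
theorem binaryValue_sweep (b : Bool) (l : List (Fin 4 → Fin (β + 2))) :
    binaryValue (sweep binaryInc b l).1 + 2 ^ l.length * (sweep binaryInc b l).2.toNat =
      binaryValue l + b.toNat := by
  induction l generalizing b with
  | nil => simp [sweep, binaryValue]
  | cons c l ih =>
    have h := ih (binaryInc b c).2
    simp only [sweep, binaryValue, List.length_cons, pow_succ]
    cases b with
    | false =>
      simp only [binaryInc, Bool.false_eq_true, if_false, Bool.toNat_false] at h ⊢
      linarith
    | true =>
      by_cases hc : c = 0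
      · simp [binaryInc, hc, one_ne_zero_cell] at h ⊢
        linarith
      · simp [binaryInc, hc] at h ⊢
        linarith

/-- The counter is the binary expansion of `n`, with one cell for `n = 0`, in accordance with
`Nat.log 2 0 = 0`. Counting the letters thus marks off logarithmic space. -/
theorem length_counter (β n : ℕ) : (counter β n).length = Nat.log 2 n + 1 := by
  have key : ∀ n, binaryValue (counter β n) = n ∧
      -- The leading bit is set, except that zero also occupies a cell; `max` accounts for that.
      ∃ l, (counter β n).length = l + 1 ∧ 2 ^ l ≤ max n 1 := by
    intro n
    induction n with
    | zero => exact ⟨by simp [counter, binaryValue], 0, rfl, by simp⟩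
    | succ n ih =>
      obtain ⟨hv, l, hl, hle⟩ := ih
      have h := binaryValue_sweep true (counter β n)
      have hlt := binaryValue_lt (counter β n)
      have hlen := length_sweep binaryInc true (counter β n)
      rw [hv, hl] at h hlt
      rw [hl] at hlen
      rw [counter]
      cases hb : (sweep binaryInc true (counter β n)).2 with
      | false =>
        rw [hb] at h
        simp only [Bool.toNat_false, mul_zero, add_zero, Bool.toNat_true] at h
        refine ⟨by simpa using h, l, by simpa using hlen, ?_⟩
        omega
      | true =>
        rw [hb] at h
        simp only [Bool.toNat_true, mul_one] at h
        refine ⟨?_, l + 1, by simp [hlen], by omega⟩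
        simp only [if_true, Option.toList_some]
        rw [binaryValue_append, hlen, h]
  obtain ⟨hv, l, hl, hle⟩ := key n
  have hlt := binaryValue_lt (counter β n)
  rw [hv, hl] at hlt
  rw [hl]
  rcases Nat.eq_zero_or_pos n with rfl | hn
  · have : l = 0 := by
      by_contra h
      have := Nat.one_lt_two_pow h
      omega
    simp [this]
  · rw [Nat.log_eq_of_pow_le_of_lt_pow (by omega) hlt]

end BinaryCounter


/-! ### Output of a grid game in logarithmic space -/

theorem SweepMachine.step_eq_of_stay {A B : Type} (M : SweepMachine A B) {w : List A}
    {q₀ q : M.Q} {l₀ l : List M.Cell} {b : Bool} {i : ℕ} {out : List B}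
    (hs : sweep (M.cell q₀) true l₀ = (l, b))
    (hf : M.finish q₀ b (Transducer.inputSymbol w i) = some (q, .stay, [], none))
    (hi : i ≤ w.length + 1) : M.step w ⟨q₀, l₀, i, out⟩ = some ⟨q, l, i, out⟩ := by
  simp [step, hs, hf, Move.apply, hi]

theorem flatMap_range_mul {α : Type} (F : ℕ → List α) (a b : ℕ) :
    (List.range (a * b)).flatMap F =
      (List.range a).flatMap fun x => (List.range b).flatMap fun y => F (x * b + y) := by
  induction a with
  | zero => simp
  | succ a ih =>
    rw [Nat.succ_mul, List.range_add, List.flatMap_append, ih, List.range_succ, List.flatMap_append,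
      List.flatMap_map]
    simp

theorem flatMap_finRange {α : Type} (n : ℕ) (F : ℕ → List α) (f : Fin n → List α)
    (h : ∀ i, f i = F i) : (List.finRange n).flatMap f = (List.range n).flatMap F := by
  rw [← List.map_coe_finRange_eq_range, List.flatMap_map]
  exact congrArg (fun g => List.flatMap g _) (funext h)

namespace GridGame

variable {A : Type} (g : GridGame A)

/-- The final `true` records that all states are targets of Player 2. -/
def bits (q : Fin (g.M + 1)) : List Bool := [decide (g.owner q = 1), g.win q, true]

/-- The bits of the state are attached to its first action, so that a loop over actions prints the
whole state. -/
def actionCode (w : List A) (N s p : ℕ) (q : Fin (g.M + 1)) (a : ℕ) : List Bool :=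
  (if a = 0 then g.bits q else []) ++ unary (g.succIndex w N s p q (Fin.ofNat _ a))

def ctlCode (w : List A) (N s p q : ℕ) : List Bool :=
  (List.range (g.k + 1)).flatMap fun a => g.actionCode w N s p (Fin.ofNat _ q) a

def rowCode (w : List A) (N s : ℕ) : List Bool :=
  (List.range N).flatMap fun p => (List.range (g.M + 1)).flatMap fun q => g.ctlCode w N s p q

theorem mem_target (w : List A) (N : ℕ) (i : Fin 2) (x : Fin ((g.toInstance w N).m + 1)) :
    x ∈ (g.toInstance w N).target i ↔ (i = 0 → g.win (g.ctlOf x) = true) :=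
  Finset.mem_filter_univ x

/-- State indices run lexicographically through row, column and control, so the code is produced by
nested loops. -/
theorem encode_toInstance (w : List A) {N : ℕ} (hN : 0 < N) : (g.toInstance w N).encode =
    List.replicate (N * N * (g.M + 1)) true ++ ([false] ++ unary (g.k + 1) ++ unary g.init) ++
      (List.range N).flatMap fun s => g.rowCode w N s := by
  have hm : (g.toInstance w N).m + 1 = N * N * (g.M + 1) := by
    have : 0 < N * N * (g.M + 1) := by positivity
    change N * N * (g.M + 1) - 1 + 1 = _
    omega
  have hcode : (List.finRange ((g.toInstance w N).m + 1)).flatMap (fun s =>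
      [decide ((g.toInstance w N).arena.owner s = 1), decide (s ∈ (g.toInstance w N).target 0),
        decide (s ∈ (g.toInstance w N).target 1)] ++
        (List.finRange ((g.toInstance w N).k + 1)).flatMap fun a =>
          unary ((g.toInstance w N).arena.trans s a)) =
      (List.range N).flatMap fun s => g.rowCode w N s := by
    rw [flatMap_finRange _ (fun x => g.ctlCode w N (g.rowOf N x) (g.colOf N x) (g.ctlOf x)), hm,
      mul_assoc, flatMap_range_mul]
    · refine List.flatMap_congr fun s hs => ?_
      rw [flatMap_range_mul, rowCode]
      refine List.flatMap_congr fun p hp => List.flatMap_congr fun q hq => ?_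
      rw [List.mem_range] at hp hq
      have hx : s * (N * (g.M + 1)) + (p * (g.M + 1) + q) = g.index N s p q := by
        rw [index]
        ring
      rw [hx, g.rowOf_index hp hq, g.colOf_index hp hq]
      rw [show g.ctlOf (g.index N s p q) = ⟨q, hq⟩ from g.ctlOf_index ⟨q, hq⟩]
    · intro x
      rw [flatMap_finRange _ (fun a => unary (g.succIndex w N (g.rowOf N x) (g.colOf N x) (g.ctlOf x)
        (Fin.ofNat _ a)))]
      · have hb : [decide ((g.toInstance w N).arena.owner x = 1),
            decide (x ∈ (g.toInstance w N).target 0), decide (x ∈ (g.toInstance w N).target 1)] =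
            g.bits (g.ctlOf x) := by
          simp only [bits, g.mem_target]
          simp only [toInstance]
          simp
          rfl
        have hq : Fin.ofNat (g.M + 1) (g.ctlOf x) = g.ctlOf x := by
          ext
          exact Nat.mod_eq_of_lt (g.ctlOf x).2
        simp only [hb, ctlCode, hq]
        change _ ++ (List.range (g.k + 1)).flatMap _ = _
        rw [List.range_succ_eq_map, List.flatMap_cons, List.flatMap_cons, List.flatMap_map,
          List.flatMap_map, ← List.append_assoc]
        congr 2
      · intro a
        rw [g.trans_val w hN]
        congr 2
        ext
        exact (Nat.mod_eq_of_lt a.2).symm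
  rw [Instance2.encode, hcode, g.init_val w hN, hm]
  simp [unary, toInstance]

/-- Control states of the machine that prints the code of a grid game. -/
inductive PrintState (g : GridGame A) where
  | start
  | count
  | countInc
  | clear
  | header
  | headerRow
  | rewind
  | testRow
  | testCol (isLast : Bool)
  | act (isLast isZero : Bool) (q : Fin (g.M + 1)) (a : Fin (g.k + 1))
  | loadRow (isLast isZero : Bool) (q : Fin (g.M + 1)) (a : Fin (g.k + 1))
      (r : Bool × Shift × Fin (g.M + 1))
  | loadCol (isLast isZero : Bool) (q : Fin (g.M + 1)) (a : Fin (g.k + 1))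
      (d : Shift) (q' : Fin (g.M + 1))
  | print (isLast isZero : Bool) (q : Fin (g.M + 1)) (a : Fin (g.k + 1)) (q' : Fin (g.M + 1))
  | printRow (isLast isZero : Bool) (q : Fin (g.M + 1)) (a : Fin (g.k + 1)) (q' : Fin (g.M + 1))
  | nextCol
  | nextRow
  | halt

instance : Finite Shift :=
  Finite.of_surjective (fun i : Fin 4 => match i with
    | 0 => Shift.keep
    | 1 => .zero
    | 2 => .inc
    | 3 => .dec) (by
      rintro (_ | _ | _ | _)
      exacts [⟨0, rfl⟩, ⟨1, rfl⟩, ⟨2, rfl⟩, ⟨3, rfl⟩])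

instance : Finite g.PrintState :=
  Finite.of_surjective
    (α := Fin 12 ⊕ Bool ⊕ (Bool × Bool × Fin (g.M + 1) × Fin (g.k + 1) ×
      (Unit ⊕ (Bool × Shift × Fin (g.M + 1)) ⊕ (Shift × Fin (g.M + 1)) ⊕ Fin (g.M + 1) ⊕
        Fin (g.M + 1))))
    (fun x => match x with
      | .inl 0 => .start
      | .inl 1 => .count
      | .inl 2 => .countInc
      | .inl 3 => .clear
      | .inl 4 => .header
      | .inl 5 => .headerRow
      | .inl 6 => .rewind
      | .inl 7 => .testRow
      | .inl 8 => .nextCol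
      | .inl 9 => .nextRow
      | .inl _ => .halt
      | .inr (.inl b) => .testCol b
      | .inr (.inr (l, z, q, a, .inl _)) => .act l z q a
      | .inr (.inr (l, z, q, a, .inr (.inl r))) => .loadRow l z q a r
      | .inr (.inr (l, z, q, a, .inr (.inr (.inl (d, q'))))) => .loadCol l z q a d q'
      | .inr (.inr (l, z, q, a, .inr (.inr (.inr (.inl q'))))) => .print l z q a q'
      | .inr (.inr (l, z, q, a, .inr (.inr (.inr (.inr q'))))) => .printRow l z q a q')
    (by
      rintro (_ | _ | _ | _ | _ | _ | _ | _ | b | ⟨l, z, q, a⟩ | ⟨l, z, q, a, r⟩ |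
        ⟨l, z, q, a, d, q'⟩ | ⟨l, z, q, a, q'⟩ | ⟨l, z, q, a, q'⟩ | _ | _ | _)
      exacts [⟨.inl 0, rfl⟩, ⟨.inl 1, rfl⟩, ⟨.inl 2, rfl⟩, ⟨.inl 3, rfl⟩, ⟨.inl 4, rfl⟩,
        ⟨.inl 5, rfl⟩, ⟨.inl 6, rfl⟩, ⟨.inl 7, rfl⟩, ⟨.inr (.inl b), rfl⟩,
        ⟨.inr (.inr (l, z, q, a, .inl ())), rfl⟩, ⟨.inr (.inr (l, z, q, a, .inr (.inl r))), rfl⟩,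
        ⟨.inr (.inr (l, z, q, a, .inr (.inr (.inl (d, q'))))), rfl⟩,
        ⟨.inr (.inr (l, z, q, a, .inr (.inr (.inr (.inl q'))))), rfl⟩,
        ⟨.inr (.inr (l, z, q, a, .inr (.inr (.inr (.inr q'))))), rfl⟩,
        ⟨.inl 8, rfl⟩, ⟨.inl 9, rfl⟩, ⟨.inl 10, rfl⟩])

/-- The state in which the code for control state `q` is begun. -/
def ctlState (isLast isZero : Bool) (q : ℕ) : g.PrintState :=
  if h : q < g.M + 1 then .act isLast isZero ⟨q, h⟩ 0 else .nextCol

/-- The state in which the code for action `a` is begun. -/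
def actState (isLast isZero : Bool) (q : Fin (g.M + 1)) (a : ℕ) : g.PrintState :=
  if h : a < g.k + 1 then .act isLast isZero q ⟨a, h⟩ else g.ctlState isLast isZero (q + 1)

end GridGame

def InSym.toOption {A : Type} : InSym A → Option A
  | .letter a => some a
  | _ => none

namespace GridGame

variable {A : Type} (g : GridGame A)

/-- `testRow` and `testCol` are run for their flags alone: a copy of register 0 overflows iff `s + 1
= N`, and a copy of register 1 underflows iff `p = 0`. -/
def printCell (β : ℕ) : g.PrintState → Bool → (Fin 4 → Fin (β + 2)) → (Fin 4 → Fin (β + 2)) × Bool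
  | .countInc => binaryInc
  | .clear => fun b _ => (0, b)
  | .header => cellOp 3 3 .inc
  | .headerRow => cellOp 2 2 .inc
  | .testRow => cellOp 2 0 .inc
  | .testCol _ => cellOp 3 1 .dec
  | .loadRow _ _ _ _ r => cellOp 2 0 (if r.1 then .inc else .keep)
  | .loadCol _ _ _ _ d _ => cellOp 3 1 d
  | .print _ _ _ _ _ => cellOp 3 3 .dec
  | .printRow _ _ _ _ _ => cellOp 2 2 .dec
  | .nextCol => cellOp 1 1 .inc
  | .nextRow => cellOp 0 0 .inc
  | _ => fun b c => (c, b)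

/-- Registers 2 and 3 form a number with two digits in base `N`: it is counted up to `N * N` for the
header and down to zero for a successor, with `g.M + 1` ones printed per unit. Within a row the
input head moves along with register 1 until it meets the right end. -/
def printFinish (β : ℕ) : g.PrintState → Bool → InSym A →
    Option (g.PrintState × Move × List Bool × Option (Fin 4 → Fin (β + 2)))
  | .start, _, _ => some (.count, .right, [], some 0)
  | .count, _, .letter _ => some (.countInc, .stay, [], none)
  | .count, _, _ => some (.clear, .stay, [], none)
  | .countInc, b, _ => some (.count, .right, [], if b then some 1 else none)
  | .clear, _, _ => some (.header, .stay, [], none)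
  | .header, true, _ => some (.headerRow, .stay, [], none)
  | .header, false, _ => some (.header, .stay, List.replicate (g.M + 1) true, none)
  | .headerRow, true, _ => some (.rewind, .stay,
      List.replicate (g.M + 1) true ++ ([false] ++ unary (g.k + 1) ++ unary g.init), none)
  | .headerRow, false, _ => some (.header, .stay, List.replicate (g.M + 1) true, none)
  | .rewind, _, .leftEnd => some (.testRow, .right, [], none)
  | .rewind, _, _ => some (.rewind, .left, [], none)
  | .testRow, b, _ => some (.testCol b, .stay, [], none)
  | .testCol l, b, _ => some (g.ctlState l b 0, .stay, [], none)
  | .act l z q a, _, x => some (.loadRow l z q a (g.move l z x.toOption q a), .stay,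
      if (a : ℕ) = 0 then g.bits q else [], none)
  | .loadRow l z q a r, _, _ => some (.loadCol l z q a r.2.1 r.2.2, .stay, [], none)
  | .loadCol l z q a _ q', _, _ => some (.print l z q a q', .stay, [], none)
  | .print l z q a q', true, _ => some (.printRow l z q a q', .stay, [], none)
  | .print l z q a q', false, _ =>
      some (.print l z q a q', .stay, List.replicate (g.M + 1) true, none)
  | .printRow l z q a q', true, _ => some (g.actState l z q (a + 1), .stay, unary q', none)
  | .printRow l z q a q', false, _ =>
      some (.print l z q a q', .stay, List.replicate (g.M + 1) true, none)
  | .nextCol, true, _ => some (.nextRow, .stay, [], none)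
  | .nextCol, false, _ => some (.testRow, .right, [], none)
  | .nextRow, true, _ => some (.halt, .stay, [], none)
  | .nextRow, false, _ => some (.rewind, .stay, [], none)
  | .halt, _, _ => none

/-- The machine that prints the code of a grid game on input `w`, where `N` is the power of `β + 2`
with exponent `Nat.log 2 w.length + 1`. Registers 0 and 1 hold the current position, and
registers 2 and 3 are used as counters. -/
def printer (β : ℕ) : SweepMachine A Bool where
  Q := g.PrintState
  Cell := Fin 4 → Fin (β + 2)
  start := .start
  cell := g.printCell β
  finish := g.printFinish β

variable (β : ℕ) (w : List A)

/-- A configuration given by the contents of the registers. -/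
def conf (l : ℕ) (st : g.PrintState) (v : Fin 4 → ℕ) (i : ℕ) (out : List Bool) :
    (g.printer β).Config :=
  ⟨st, regs β l v, i, out⟩

/-! ### Correctness of the printing machine -/

variable {β w} {l L N : ℕ}

theorem reaches_op (hl : l ≤ L) (hN : (β + 2) ^ l = N) {st st' : g.PrintState} {v v' : Fin 4 → ℕ}
    {i i' : ℕ} {out o : List Bool} {m : Move} {dst src : Fin 4} {d : Shift} (f : Bool)
    (hcell : g.printCell β st = cellOp dst src d) (hsrc : v src < N)
    (hv : Function.update v dst (d.apply N (v src)) = v') (hf : d.flag N (v src) = f)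
    (hfin : g.printFinish β st f (Transducer.inputSymbol w i) = some (st', m, o, none))
    (hi : min (m.apply i) (w.length + 1) = i') :
    (g.printer β).Reaches w L (g.conf β l st v i out) (g.conf β l st' v' i' (out ++ o)) := by
  subst hv hi hN hf
  refine .single ⟨?_, (length_regs _ _ _).trans_le hl⟩
  have hs := sweep_cellOp β l dst src d v hsrc
  simp only [SweepMachine.step, conf, printer, hcell, hs, hfin, Option.toList_none]
  exact congrArg (fun m => some (⟨st', m, _, _⟩ : (g.printer β).Config)) (List.append_nil _)

theorem reaches_nop (hl : l ≤ L) {st st' : g.PrintState} {v : Fin 4 → ℕ} {i i' : ℕ}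
    {out o : List Bool} {m : Move} (hcell : g.printCell β st = fun b c => (c, b))
    (hfin : g.printFinish β st true (Transducer.inputSymbol w i) = some (st', m, o, none))
    (hi : min (m.apply i) (w.length + 1) = i') :
    (g.printer β).Reaches w L (g.conf β l st v i out) (g.conf β l st' v i' (out ++ o)) := by
  subst hi
  refine .single ⟨?_, (length_regs _ _ _).trans_le hl⟩
  have hs := sweep_id true (regs β l v)
  simp only [SweepMachine.step, conf, printer, hcell, hs, hfin, Option.toList_none]
  exact congrArg (fun m => some (⟨st', m, _, _⟩ : (g.printer β).Config)) (List.append_nil _)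

theorem dec_apply_pos {N x : ℕ} (hx : 0 < x) (hN : x < N) : Shift.dec.apply N x = x - 1 := by
  rw [Shift.apply, show x + N - 1 = x - 1 + N by omega, Nat.add_mod_right, Nat.mod_eq_of_lt (by omega)]

theorem dec_apply_zero {N : ℕ} (hN : 0 < N) : Shift.dec.apply N 0 = N - 1 := by
  rw [Shift.apply, zero_add, Nat.mod_eq_of_lt (by omega)]

theorem inc_apply_lt {N x : ℕ} (hx : x + 1 < N) : Shift.inc.apply N x = x + 1 :=
  Nat.mod_eq_of_lt hx

theorem inc_apply_last {N x : ℕ} (hx : x + 1 = N) : Shift.inc.apply N x = 0 := by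
  rw [Shift.apply, hx, Nat.mod_self]

theorem append_replicate_mul (out : List Bool) (n k : ℕ) :
    out ++ List.replicate k true ++ List.replicate (n * k) true =
      out ++ List.replicate ((n + 1) * k) true := by
  rw [List.append_assoc, List.replicate_append_replicate, Nat.succ_mul, add_comm]

theorem replicate_append_unary (a b : ℕ) : List.replicate a true ++ unary b = unary (a + b) := by
  rw [unary, ← List.append_assoc, List.replicate_append_replicate, unary]

/-- The value of the counter in registers 2 and 3 is printed in unary. -/
theorem reaches_print (hl : l ≤ L) (hN : (β + 2) ^ l = N) (b z : Bool) (q : Fin (g.M + 1))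
    (a : Fin (g.k + 1)) (q' : Fin (g.M + 1)) (s p : ℕ) {i : ℕ} (hi : i ≤ w.length + 1) (n : ℕ)
    {y x : ℕ} (hy : y < N) (hx : x < N) (hn : y * N + x = n) (out : List Bool) :
    (g.printer β).Reaches w L (g.conf β l (.print b z q a q') ![s, p, y, x] i out)
      (g.conf β l (g.actState b z q (a + 1)) ![s, p, N - 1, N - 1] i
        (out ++ List.replicate (n * (g.M + 1)) true ++ unary q')) := by
  have hN0 : 0 < N := by omega
  rcases Nat.eq_zero_or_pos x with rfl | hx0
  · have h1 := g.reaches_op (w := w) (out := out) hl hN (st := .print b z q a q') (i' := i)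
      (v := ![s, p, y, 0]) true rfl hx (update_reg₃ (dec_apply_zero hN0)) rfl rfl (min_eq_left hi)
    refine h1.trans ?_
    rw [List.append_nil]
    rcases Nat.eq_zero_or_pos y with rfl | hy0
    · obtain rfl : n = 0 := by omega
      have h2 := g.reaches_op (w := w) (out := out) hl hN (st := .printRow b z q a q') (i' := i)
        (v := ![s, p, 0, N - 1]) true rfl hN0 (update_reg₂ (dec_apply_zero hN0)) rfl rfl
        (min_eq_left hi)
      simpa using h2
    · have h2 := g.reaches_op (w := w) (out := out) hl hN (st := .printRow b z q a q') (i' := i)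
        (v := ![s, p, y, N - 1]) false rfl hy (update_reg₂ (dec_apply_pos hy0 hy))
        (decide_eq_false hy0.ne') rfl (min_eq_left hi)
      obtain ⟨n, rfl⟩ : ∃ n', n = n' + 1 := ⟨n - 1, by have := Nat.mul_pos hy0 hN0; omega⟩
      -- Borrowing from the upper digit: `y * N = (y - 1) * N + (N - 1) + 1`.
      have h3 := reaches_print hl hN b z q a q' s p hi n (y := y - 1) (x := N - 1) (by omega)
        (by omega) (by
          obtain ⟨y, rfl⟩ : ∃ y', y = y' + 1 := ⟨y - 1, by omega⟩
          rw [Nat.add_sub_cancel]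
          rw [Nat.succ_mul] at hn
          omega) (out ++ List.replicate (g.M + 1) true)
      rw [append_replicate_mul] at h3
      exact h2.trans h3
  · have h2 := g.reaches_op (w := w) (out := out) hl hN (st := .print b z q a q') (i' := i)
      (v := ![s, p, y, x]) false rfl hx (update_reg₃ (dec_apply_pos hx0 hx))
      (decide_eq_false hx0.ne') rfl (min_eq_left hi)
    obtain ⟨n, rfl⟩ : ∃ n', n = n' + 1 := ⟨n - 1, by omega⟩
    have h3 := reaches_print hl hN b z q a q' s p hi n (y := y) (x := x - 1) hy
      (by omega) (by omega) (out ++ List.replicate (g.M + 1) true)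
    rw [append_replicate_mul] at h3
    exact h2.trans h3
termination_by n

/-- Column `p` corresponds to tape cell `p + 1`; columns beyond the word see the right end marker,
where the head waits. -/
theorem toOption_inputSymbol (w : List A) (p : ℕ) :
    (Transducer.inputSymbol w (min (p + 1) (w.length + 1))).toOption = w[p]? := by
  have h : min (p + 1) (w.length + 1) ≠ 0 := by omega
  rw [Transducer.inputSymbol, if_neg h]
  rcases Nat.lt_or_ge p w.length with hp | hp
  · rw [show min (p + 1) (w.length + 1) - 1 = p by omega, List.getElem?_eq_getElem hp]
    rfl
  · rw [show min (p + 1) (w.length + 1) - 1 = w.length by omega, List.getElem?_eq_none le_rfl,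
      List.getElem?_eq_none hp]
    rfl

/-- The two flags and the scanned letter determine the move; the row and column of the successor are
loaded into the counters and printed together with its control state. -/
theorem reaches_act (hl : l ≤ L) (hN : (β + 2) ^ l = N) {s p : ℕ} (hs : s < N) (hp : p < N)
    (q : Fin (g.M + 1)) (a : Fin (g.k + 1)) (y x : ℕ) (out : List Bool) :
    (g.printer β).Reaches w L
      (g.conf β l (.act (decide (s + 1 = N)) (decide (p = 0)) q a) ![s, p, y, x]
        (min (p + 1) (w.length + 1)) out)
      (g.conf β l (g.actState (decide (s + 1 = N)) (decide (p = 0)) q (a + 1)) ![s, p, N - 1, N - 1]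
        (min (p + 1) (w.length + 1)) (out ++ g.actionCode w N s p q a)) := by
  have hi : min (p + 1) (w.length + 1) ≤ w.length + 1 := min_le_right _ _
  have hN0 : 0 < N := by omega
  have h1 := g.reaches_nop (w := w) (out := out) (β := β) hl (i' := min (p + 1) (w.length + 1))
    (st := .act (decide (s + 1 = N)) (decide (p = 0)) q a) (v := ![s, p, y, x]) rfl rfl
    (min_eq_left hi)
  rw [toOption_inputSymbol] at h1
  set r := g.moveAt w N s p q a with hr
  change (g.printer β).Reaches w L _ (g.conf β l (.loadRow _ _ q a r) _ _ _) at h1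
  have hrow : (if r.1 then Shift.inc else .keep).apply N s = (s + r.1.toNat) % N := by
    cases r.1
    · exact (Nat.mod_eq_of_lt hs).symm
    · rfl
  have h2 := g.reaches_op (w := w) (out := out ++ if (a : ℕ) = 0 then g.bits q else []) (o := [])
    hl hN (i' := min (p + 1) (w.length + 1)) (m := .stay)
    (st := .loadRow (decide (s + 1 = N)) (decide (p = 0)) q a r)
    (st' := .loadCol (decide (s + 1 = N)) (decide (p = 0)) q a r.2.1 r.2.2)
    (v := ![s, p, y, x]) _ rfl hs (update_reg₂ hrow) rfl rfl (min_eq_left hi)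
  have h3 := g.reaches_op (w := w) (out := (out ++ if (a : ℕ) = 0 then g.bits q else []) ++ [])
    (o := []) hl hN (i' := min (p + 1) (w.length + 1)) (m := .stay)
    (st := .loadCol (decide (s + 1 = N)) (decide (p = 0)) q a r.2.1 r.2.2)
    (st' := .print (decide (s + 1 = N)) (decide (p = 0)) q a r.2.2)
    (v := ![s, p, (s + r.1.toNat) % N, x]) _ rfl hp (update_reg₃ rfl) rfl rfl (min_eq_left hi)
  have h4 := g.reaches_print (w := w) hl hN (decide (s + 1 = N)) (decide (p = 0)) q a r.2.2 s p hi _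
    (Nat.mod_lt (s + r.1.toNat) hN0) (Shift.apply_lt r.2.1 hp) rfl
    (((out ++ if (a : ℕ) = 0 then g.bits q else []) ++ []) ++ [])
  have h := ((h1.trans h2).trans h3).trans h4
  have ha : Fin.ofNat (g.k + 1) a = a := by
    ext
    exact Nat.mod_eq_of_lt a.2
  rw [List.append_nil, List.append_nil, List.append_assoc, List.append_assoc,
    replicate_append_unary] at h
  rw [actionCode, ha]
  exact h

/-- A loop that produces the output `E a` in round `a`. -/
theorem reaches_loop (M : SweepMachine A Bool) {w : List A} {L : ℕ}
    (P : ℕ → List Bool → M.Config → Prop) (E : ℕ → List Bool) (n : ℕ)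
    (h : ∀ a < n, ∀ out c, P a out c → ∃ d, M.Reaches w L c d ∧ P (a + 1) (out ++ E a) d)
    {out : List Bool} {c : M.Config} (hc : P 0 out c) :
    ∃ d, M.Reaches w L c d ∧ P n (out ++ (List.range n).flatMap E) d := by
  induction n with
  | zero => exact ⟨c, .refl, by simpa using hc⟩
  | succ n ih =>
    obtain ⟨d, hd, hP⟩ := ih fun a ha => h a (by omega)
    obtain ⟨e, he, hQ⟩ := h n (by omega) _ _ hP
    refine ⟨e, hd.trans he, ?_⟩
    simpa [List.range_succ] using hQ

theorem actState_of_lt (b z : Bool) (q : Fin (g.M + 1)) {a : ℕ} (ha : a < g.k + 1) :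
    g.actState b z q a = .act b z q ⟨a, ha⟩ := dif_pos ha

theorem ctlState_of_lt (b z : Bool) {q : ℕ} (hq : q < g.M + 1) :
    g.ctlState b z q = .act b z ⟨q, hq⟩ 0 := dif_pos hq

theorem reaches_ctl (hl : l ≤ L) (hN : (β + 2) ^ l = N) {s p : ℕ} (hs : s < N) (hp : p < N)
    {q : ℕ} (hq : q < g.M + 1) (y x : ℕ) (out : List Bool) :
    ∃ y' x', (g.printer β).Reaches w L
      (g.conf β l (g.ctlState (decide (s + 1 = N)) (decide (p = 0)) q) ![s, p, y, x]
        (min (p + 1) (w.length + 1)) out)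
      (g.conf β l (g.ctlState (decide (s + 1 = N)) (decide (p = 0)) (q + 1)) ![s, p, y', x']
        (min (p + 1) (w.length + 1)) (out ++ g.ctlCode w N s p q)) := by
  obtain ⟨d, hd, y', x', rfl⟩ := reaches_loop (g.printer β) (w := w) (L := L)
    (fun a out c => ∃ y x, c = g.conf β l (g.actState (decide (s + 1 = N)) (decide (p = 0)) ⟨q, hq⟩ a)
      ![s, p, y, x] (min (p + 1) (w.length + 1)) out)
    (fun a => g.actionCode w N s p (Fin.ofNat _ q) a) (g.k + 1)
    (by
      rintro a ha out _ ⟨y, x, rfl⟩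
      refine ⟨_, ?_, N - 1, N - 1, rfl⟩
      have h := g.reaches_act (w := w) hl hN hs hp ⟨q, hq⟩ ⟨a, ha⟩ y x out
      have hq' : Fin.ofNat (g.M + 1) q = ⟨q, hq⟩ := by
        ext
        exact Nat.mod_eq_of_lt hq
      rw [g.actState_of_lt _ _ _ ha, hq']
      exact h) (out := out) ⟨y, x, rfl⟩
  refine ⟨y', x', ?_⟩
  rw [g.ctlState_of_lt _ _ hq]
  rw [g.actState_of_lt _ _ _ (Nat.succ_pos _)] at hd
  -- After the last action `actState` passes to the next control state.
  have hend : g.actState (decide (s + 1 = N)) (decide (p = 0)) ⟨q, hq⟩ (g.k + 1) =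
      g.ctlState (decide (s + 1 = N)) (decide (p = 0)) (q + 1) := dif_neg (lt_irrefl _)
  rw [hend] at hd
  exact hd

/-- The head of the input tape returns to the first letter. -/
theorem reaches_rewind (hl : l ≤ L) (v : Fin 4 → ℕ) {i : ℕ} (hi : i ≤ w.length + 1)
    (out : List Bool) :
    (g.printer β).Reaches w L (g.conf β l .rewind v i out)
      (g.conf β l .testRow v (min 1 (w.length + 1)) out) := by
  induction i with
  | zero =>
    have h := g.reaches_nop (w := w) (out := out) (β := β) (o := []) hl (st := .rewind)
      (st' := .testRow) (v := v) (i := 0) (m := .right) (i' := min 1 (w.length + 1)) rfl rfl rfl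
    rw [List.append_nil] at h
    exact h
  | succ i ih =>
    have hfin : g.printFinish β .rewind true (Transducer.inputSymbol w (i + 1)) =
        some (.rewind, .left, [], none) := by
      rw [Transducer.inputSymbol, if_neg (Nat.succ_ne_zero i)]
      cases w[i + 1 - 1]? <;> rfl
    have h := g.reaches_nop (w := w) (out := out) (β := β) hl (v := v) (i := i + 1) rfl hfin
      (i' := i) (min_eq_left (by change i ≤ _; omega))
    rw [List.append_nil] at h
    exact h.trans (ih (by omega))

theorem reaches_row (hl : l ≤ L) (hN : (β + 2) ^ l = N) {s : ℕ} (hs : s < N)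
    (y x : ℕ) {i : ℕ} (hi : i ≤ w.length + 1) (out : List Bool) :
    ∃ y' x' i', i' ≤ w.length + 1 ∧ (g.printer β).Reaches w L
      (g.conf β l .rewind ![s, 0, y, x] i out)
      (g.conf β l .nextRow ![s, 0, y', x'] i' (out ++ g.rowCode w N s)) := by
  have hN0 : 0 < N := by omega
  obtain ⟨d, hd, y', x', h⟩ := reaches_loop (g.printer β) (w := w) (L := L)
    -- The invariant has two cases because the last round leaves the loop with the column register
    -- wrapped to zero.
    (fun p out c => ∃ y x, (p < N ∧ c = g.conf β l .testRow ![s, p, y, x]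
        (min (p + 1) (w.length + 1)) out) ∨
      (p = N ∧ c = g.conf β l .nextRow ![s, 0, y, x] (min p (w.length + 1)) out))
    (fun p => (List.range (g.M + 1)).flatMap fun q => g.ctlCode w N s p q) N
    (by
      rintro p hp out c ⟨y, x, ⟨-, rfl⟩ | ⟨rfl, -⟩⟩
      swap
      · exact (lt_irrefl _ hp).elim
      have hi : min (p + 1) (w.length + 1) ≤ w.length + 1 := min_le_right _ _
      have h1 := g.reaches_op (w := w) (out := out) hl hN (st := .testRow)
        (st' := .testCol (decide (s + 1 = N))) (o := []) (m := .stay)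
        (i' := min (p + 1) (w.length + 1)) (v := ![s, p, y, x]) _ rfl hs (update_reg₂ rfl) rfl rfl
        (min_eq_left hi)
      have h2 := g.reaches_op (w := w) (out := out ++ []) hl hN (st := .testCol (decide (s + 1 = N)))
        (st' := g.ctlState (decide (s + 1 = N)) (decide (p = 0)) 0) (o := []) (m := .stay)
        (i' := min (p + 1) (w.length + 1)) (v := ![s, p, Shift.inc.apply N s, x]) _ rfl hp
        (update_reg₃ rfl) rfl rfl (min_eq_left hi)
      have h12 := h1.trans h2
      rw [List.append_nil, List.append_nil] at h12
      obtain ⟨d, hd, y', x', rfl⟩ := reaches_loop (g.printer β) (w := w) (L := L)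
        (fun q out c => ∃ y x, c = g.conf β l (g.ctlState (decide (s + 1 = N)) (decide (p = 0)) q)
          ![s, p, y, x] (min (p + 1) (w.length + 1)) out)
        (fun q => g.ctlCode w N s p q) (g.M + 1)
        (by
          rintro q hq out _ ⟨y, x, rfl⟩
          obtain ⟨y', x', h⟩ := g.reaches_ctl (w := w) hl hN hs hp hq y x out
          exact ⟨_, h, y', x', rfl⟩) (out := out) ⟨_, _, rfl⟩
      have hend : g.ctlState (decide (s + 1 = N)) (decide (p = 0)) (g.M + 1) = .nextCol :=
        dif_neg (lt_irrefl _)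
      rw [hend] at hd
      by_cases hlast : p + 1 = N
      · have h3 := g.reaches_op (w := w) (out := out ++ (List.range (g.M + 1)).flatMap fun q =>
          g.ctlCode w N s p q) hl hN (st := .nextCol) (i' := min (p + 1) (w.length + 1))
          (v := ![s, p, y', x']) true rfl hp (update_reg₁ (inc_apply_last hlast))
          (decide_eq_true hlast) rfl (min_eq_left hi)
        rw [List.append_nil] at h3
        exact ⟨_, (h12.trans hd).trans h3, y', x', .inr ⟨hlast, rfl⟩⟩
      · have h3 := g.reaches_op (w := w) (out := out ++ (List.range (g.M + 1)).flatMap fun q =>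
          g.ctlCode w N s p q) hl hN (st := .nextCol) (i := min (p + 1) (w.length + 1))
          (i' := min (p + 1 + 1) (w.length + 1))
          (v := ![s, p, y', x']) false rfl hp (update_reg₁ (inc_apply_lt (x := p) (by omega)))
          (decide_eq_false hlast) rfl (by change min (min _ _ + 1) _ = _; omega)
        rw [List.append_nil] at h3
        exact ⟨_, (h12.trans hd).trans h3, y', x', .inl ⟨by omega, rfl⟩⟩)
    (out := out) (c := g.conf β l .testRow ![s, 0, y, x] (min 1 (w.length + 1)) out)
    ⟨y, x, .inl ⟨hN0, by rw [zero_add]⟩⟩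
  rcases h with ⟨h, -⟩ | ⟨-, rfl⟩
  · exact (lt_irrefl _ h).elim
  · exact ⟨y', x', _, min_le_right _ _, (g.reaches_rewind hl _ hi out).trans hd⟩

theorem reaches_rows (hl : l ≤ L) (hN : (β + 2) ^ l = N) (y x : ℕ) {i : ℕ}
    (hi : i ≤ w.length + 1) (out : List Bool) :
    ∃ v i', (g.printer β).Reaches w L (g.conf β l .rewind ![0, 0, y, x] i out)
      (g.conf β l .halt v i' (out ++ (List.range N).flatMap fun s => g.rowCode w N s)) := by
  have hN0 : 0 < N := by
    rw [← hN]
    positivity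
  obtain ⟨d, hd, y', x', i', hi', h⟩ := reaches_loop (g.printer β) (w := w) (L := L)
    (fun s out c => ∃ y x i, i ≤ w.length + 1 ∧
      ((s < N ∧ c = g.conf β l .rewind ![s, 0, y, x] i out) ∨
        (s = N ∧ c = g.conf β l .halt ![0, 0, y, x] i out)))
    (fun s => g.rowCode w N s) N
    (by
      rintro s hs out c ⟨y, x, i, hi, ⟨-, rfl⟩ | ⟨rfl, -⟩⟩
      swap
      · exact (lt_irrefl _ hs).elim
      obtain ⟨y', x', i', hi', h⟩ := g.reaches_row (w := w) hl hN hs y x hi out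
      by_cases hlast : s + 1 = N
      · have h3 := g.reaches_op (w := w) (out := out ++ g.rowCode w N s) hl hN (st := .nextRow)
          (i' := i') (v := ![s, 0, y', x']) true rfl hs (update_reg₀ (inc_apply_last hlast))
          (decide_eq_true hlast) rfl (min_eq_left hi')
        rw [List.append_nil] at h3
        exact ⟨_, h.trans h3, y', x', i', hi', .inr ⟨hlast, rfl⟩⟩
      · have h3 := g.reaches_op (w := w) (out := out ++ g.rowCode w N s) hl hN (st := .nextRow)
          (i' := i') (v := ![s, 0, y', x']) false rfl hs
          (update_reg₀ (inc_apply_lt (x := s) (by omega))) (decide_eq_false hlast) rfl (min_eq_left hi')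
        rw [List.append_nil] at h3
        exact ⟨_, h.trans h3, y', x', i', hi', .inl ⟨by omega, rfl⟩⟩)
    (out := out) ⟨y, x, i, hi, .inl ⟨hN0, rfl⟩⟩
  rcases h with ⟨h, -⟩ | ⟨-, rfl⟩
  · exact (lt_irrefl _ h).elim
  · exact ⟨_, i', hd⟩

/-- Induction on the number `n` of increments left before the two-digit counter wraps around at `N *
N`; each of them prints `g.M + 1` ones. -/
theorem reaches_header (hl : l ≤ L) (hN : (β + 2) ^ l = N) {i : ℕ} (hi : i ≤ w.length + 1) (n : ℕ)
    {y x : ℕ} (hy : y < N) (hx : x < N) (hn : y * N + x + n = N * N) (out : List Bool) :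
    (g.printer β).Reaches w L (g.conf β l .header ![0, 0, y, x] i out)
      (g.conf β l .rewind ![0, 0, 0, 0] i (out ++ (List.replicate (n * (g.M + 1)) true ++
        ([false] ++ unary (g.k + 1) ++ unary g.init)))) := by
  have hn0 : n ≠ 0 := by
    rintro rfl
    nlinarith
  obtain ⟨n, rfl⟩ := Nat.exists_eq_succ_of_ne_zero hn0
  rw [← List.append_assoc, ← append_replicate_mul]
  by_cases hxl : x + 1 = N
  · have h1 := g.reaches_op (w := w) (out := out) hl hN (st := .header) (i' := i)
      (v := ![0, 0, y, x]) true rfl hx (update_reg₃ (inc_apply_last hxl)) (decide_eq_true hxl) rfl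
      (min_eq_left hi)
    rw [List.append_nil] at h1
    refine h1.trans ?_
    by_cases hyl : y + 1 = N
    · have h2 := g.reaches_op (w := w) (out := out) hl hN (st := .headerRow) (i' := i)
        (v := ![0, 0, y, 0]) true rfl hy (update_reg₂ (inc_apply_last hyl)) (decide_eq_true hyl) rfl
        (min_eq_left hi)
      have : n = 0 := by
        subst hyl
        have : (y + 1) * (y + 1) = y * (y + 1) + (y + 1) := by ring
        omega
      subst this
      simpa using h2
    · have h2 := g.reaches_op (w := w) (out := out) hl hN (st := .headerRow) (i' := i)
        (v := ![0, 0, y, 0]) false rfl hy (update_reg₂ (inc_apply_lt (x := y) (by omega)))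
        (decide_eq_false hyl) rfl (min_eq_left hi)
      have h3 := reaches_header hl hN hi n (y := y + 1) (x := 0) (by omega) (by omega)
        (by rw [Nat.succ_mul]; omega) (out ++ List.replicate (g.M + 1) true)
      rw [← List.append_assoc] at h3
      exact h2.trans h3
  · have h2 := g.reaches_op (w := w) (out := out) hl hN (st := .header) (i' := i)
      (v := ![0, 0, y, x]) false rfl hx (update_reg₃ (inc_apply_lt (x := x) (by omega)))
      (decide_eq_false hxl) rfl (min_eq_left hi)
    have h3 := reaches_header hl hN hi n (y := y) (x := x + 1) hy (by omega) (by omega)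
      (out ++ List.replicate (g.M + 1) true)
    rw [← List.append_assoc] at h3
    exact h2.trans h3
termination_by n

theorem reaches_count (w : List A) (j : ℕ) (hj : j ≤ w.length) :
    (g.printer β).Reaches w (Nat.log 2 w.length + 1) (g.printer β).initial
      ⟨.count, counter β j, j + 1, []⟩ := by
  induction j with
  | zero =>
    refine .single ⟨?_, Nat.succ_le_succ (Nat.zero_le _)⟩
    exact congrArg (fun i => some (⟨.count, counter β 0, i, []⟩ : (g.printer β).Config))
      (min_eq_left (show 1 ≤ w.length + 1 by omega))
  | succ j ih =>
    refine (ih (by omega)).trans (.tail (b := ⟨.countInc, counter β j, j + 1, []⟩)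
      (.single ⟨?_, ?_⟩) ⟨?_, ?_⟩)
    · have hs : Transducer.inputSymbol w (j + 1) = .letter w[j] := by
        simp [Transducer.inputSymbol, List.getElem?_eq_getElem hj]
      refine (g.printer β).step_eq_of_stay (sweep_id true (counter β j)) ?_ (by omega)
      change g.printFinish β .count true (Transducer.inputSymbol w (j + 1)) = _
      rw [hs]
      rfl
    · change (counter β j).length ≤ _
      rw [length_counter]
      exact Nat.succ_le_succ (Nat.log_mono_right (by omega))
    · exact congrArg (fun i => some (⟨.count, counter β (j + 1), i, []⟩ : (g.printer β).Config))
        (min_eq_left (show j + 1 + 1 ≤ w.length + 1 by omega))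
    · change (counter β (j + 1)).length ≤ _
      rw [length_counter]
      exact Nat.succ_le_succ (Nat.log_mono_right hj)

/-- The cells of the binary counter are reused, once zeroed, as the digits of the four registers in
base `β + 2`. -/
theorem reaches_clear (w : List A) :
    (g.printer β).Reaches w (Nat.log 2 w.length + 1) (g.printer β).initial
      (g.conf β (Nat.log 2 w.length + 1) .header ![0, 0, 0, 0] (w.length + 1) []) := by
  refine (g.reaches_count w w.length le_rfl).trans (.tail
    (b := ⟨.clear, counter β w.length, w.length + 1, []⟩) (.single ⟨?_, ?_⟩) ⟨?_, ?_⟩)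
  · have hs : Transducer.inputSymbol w (w.length + 1) = .rightEnd := by
      simp [Transducer.inputSymbol]
    refine (g.printer β).step_eq_of_stay (sweep_id true (counter β w.length)) ?_ le_rfl
    change g.printFinish β .count true (Transducer.inputSymbol w (w.length + 1)) = _
    rw [hs]
    rfl
  · exact (length_counter _ _).le
  · have hz : ![0, 0, 0, 0] = fun _ : Fin 4 => 0 := by
      funext i
      fin_cases i <;> rfl
    rw [conf, hz, regs_zero, ← length_counter β]
    exact (g.printer β).step_eq_of_stay (sweep_const 0 true (counter β w.length)) rfl le_rfl
  · exact (length_regs _ _ _).le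

/-- The code of a grid game can be printed in logarithmic space. -/
theorem logSpaceComputable_encode (β : ℕ) : LogSpaceComputable fun w : List A =>
    (g.toInstance w ((β + 2) ^ (Nat.log 2 w.length + 1))).encode := by
  refine (g.printer β).logSpaceComputable fun w => ?_
  have hN0 : 0 < (β + 2) ^ (Nat.log 2 w.length + 1) := by positivity
  have h1 := g.reaches_header (w := w) (β := β) le_rfl rfl le_rfl
    ((β + 2) ^ (Nat.log 2 w.length + 1) * (β + 2) ^ (Nat.log 2 w.length + 1)) hN0 hN0
    (by rw [zero_mul, add_zero, zero_add]) []
  obtain ⟨v, i, h2⟩ := g.reaches_rows (w := w) (β := β) le_rfl rfl 0 0 le_rfl _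
  refine ⟨_, ((g.reaches_clear w).trans h1).trans h2, rfl, ?_⟩
  rw [g.encode_toInstance w hN0]
  rfl

end GridGame


/-! ### Hardness -/

/-- From `n ≤ 2 ^ (Nat.log 2 n + 1)` follows `n ^ d ≤ (2 ^ d) ^ (Nat.log 2 n + 1)`, so a polynomial
is absorbed by a constant base. The `- 1` is there because a grid with `N` rows covers `N - 1`
steps. -/
theorem exists_base_pow_ge (P : Polynomial ℕ) :
    ∃ β, ∀ n, P.eval n ≤ (β + 2) ^ (Nat.log 2 n + 1) - 1 := by
  have hbound : ∃ d, ∀ n, P.eval n + 1 ≤ (2 ^ (d + 1)) ^ (Nat.log 2 n + 1) := by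
    have key : ∀ n : ℕ, n ≤ 2 ^ (Nat.log 2 n + 1) := fun n =>
      (Nat.lt_pow_succ_log_self one_lt_two n).le
    induction P using Polynomial.induction_on' with
    | add p q hp hq =>
      obtain ⟨d, hd⟩ := hp
      obtain ⟨e, he⟩ := hq
      -- The bounds are multiplied: `(p + 1) * (q + 1)` is at least `p + q + 1`.
      refine ⟨d + e + 1, fun n => ?_⟩
      have h1 := hd n
      have h2 := he n
      rw [Polynomial.eval_add, show d + e + 1 + 1 = (d + 1) + (e + 1) by ring, pow_add 2, mul_pow]
      nlinarith
    | monomial d a =>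
      refine ⟨a + d, fun n => ?_⟩
      rw [Polynomial.eval_monomial, show a + d + 1 = (a + 1) + d by ring, pow_add 2, mul_pow]
      have h1 : a + 1 ≤ (2 ^ (a + 1)) ^ (Nat.log 2 n + 1) :=
        (Nat.lt_two_pow_self (n := a + 1)).le.trans (Nat.le_self_pow (Nat.succ_ne_zero _) _)
      have h2 : n ^ d ≤ (2 ^ d) ^ (Nat.log 2 n + 1) := by
        rw [← pow_mul, mul_comm, pow_mul]
        exact Nat.pow_le_pow_left (key n) d
      have h3 : 1 ≤ (2 ^ d) ^ (Nat.log 2 n + 1) := Nat.one_le_pow _ _ (by positivity)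
      nlinarith
  obtain ⟨d, hd⟩ := hbound
  refine ⟨2 ^ (d + 1) - 2, fun n => ?_⟩
  have h : 2 ≤ 2 ^ (d + 1) := Nat.le_self_pow (Nat.succ_ne_zero _) _
  rw [Nat.sub_add_cancel h]
  have := hd n
  omega

theorem exists_equiv_fin_succ (α : Type) [Finite α] [Nonempty α] :
    ∃ n, Nonempty (α ≃ Fin (n + 1)) := by
  obtain ⟨n, ⟨e⟩⟩ := Finite.exists_equiv_fin α
  cases n with
  | zero => exact (e (Classical.arbitrary α)).elim0
  | succ n => exact ⟨n, ⟨e⟩⟩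

/-- A won game stays won under every action, so the target of Player 1 is absorbing. -/
theorem StackMachine.game_trans_mem_target {C K Γ A : Type} (M : StackMachine C K Γ) {mm kk : ℕ}
    (eP : GamePos C K Γ ≃ Fin (mm + 1)) (eA : GameAct C Γ ≃ Fin (kk + 1)) (c₀ : C) (k₀ k₁ : K)
    (letter : A → Γ) (yes : Γ) (w : List A) {N : ℕ} (hN : 0 < N) (x a)
    (hx : x ∈ (((M.game eP eA c₀ k₀ k₁ letter yes).toInstance w N).target 0 : Set _)) :
    ((M.game eP eA c₀ k₀ k₁ letter yes).toInstance w N).arena.trans x a ∈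
      (((M.game eP eA c₀ k₀ k₁ letter yes).toInstance w N).target 0 : Set _) := by
  let g := M.game eP eA c₀ k₀ k₁ letter yes
  have hwin := M.game_win_eq_true_iff eP eA c₀ k₀ k₁ letter yes
  have h1 := (hwin _).1 ((g.mem_target w N 0 x).1 hx rfl)
  refine (g.mem_target w N 0 _).2 fun _ => (hwin _).2 ?_
  refine (congrArg eP.symm ((congrArg g.ctlOf (g.trans_val w hN x a)).trans
    (g.ctlOf_succIndex w _ _))).trans ?_
  change eP.symm (eP _) = _
  rw [eP.symm_apply_apply, h1]
  rfl

theorem GridGame.target_one {A : Type} (g : GridGame A) (w : List A) (N : ℕ) :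
    ((g.toInstance w N).target 1 : Set (Fin ((g.toInstance w N).m + 1))) = Set.univ :=
  Set.eq_univ_of_forall fun x => (g.mem_target w N 1 x).2 fun h => absurd h (by decide)

/-- A problem on instances is hard if its objectives amount to reaching an absorbing target of
Player 1 whenever all states belong to the target of Player 2. -/
theorem pTimeHard_of_forall_iff {obj : ∀ {S : Type}, Set S → Set (ℕ → S)}
    (huniv : ∀ {S : Type} [Finite S] (ρ : ℕ → S), ρ ∈ obj (Set.univ : Set S))
    (hiff : ∀ {S Act : Type} [Finite S] {G : Arena 2 S Act} {T : Set S},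
      (∀ s a, s ∈ T → G.trans s a ∈ T) → ∀ {ρ : ℕ → S}, ρ ∈ G.Plays → (ρ ∈ obj T ↔ ∃ j, ρ j ∈ T)) :
    PTimeHard {w | ∃ I : Instance2, w = I.encode ∧
      I.arena.HasDoomsdayEquilibrium fun i => obj (I.target i : Set (Fin (I.m + 1)))} := by
  intro A _ L hL
  obtain ⟨C, K, Γ, _, _, _, _, M, c₀, k₀, k₁, letter, yes, P, h⟩ := hL.exists_stackMachine
  obtain ⟨β, hβ⟩ := exists_base_pow_ge P
  have : Nonempty (StackMachine.GamePos C K Γ) := ⟨.inl (.inr true)⟩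
  have : Nonempty (StackMachine.GameAct C Γ) := ⟨(true, c₀, none)⟩
  obtain ⟨mm, ⟨eP⟩⟩ := exists_equiv_fin_succ (StackMachine.GamePos C K Γ)
  obtain ⟨kk, ⟨eA⟩⟩ := exists_equiv_fin_succ (StackMachine.GameAct C Γ)
  let g := M.game eP eA c₀ k₀ k₁ letter yes
  refine ⟨_, g.logSpaceComputable_encode β, fun w => ?_⟩
  have hN : 0 < (β + 2) ^ (Nat.log 2 w.length + 1) := by positivity
  rw [h w _ (hβ w.length), ← M.game_hasDoomsdayEquilibrium_iff eP eA c₀ k₀ k₁ letter yes w hN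
    (φ := fun i => obj ((g.toInstance w ((β + 2) ^ (Nat.log 2 w.length + 1))).target i : Set (Fin _)))]
  · constructor
    · exact fun h => ⟨_, rfl, h⟩
    · rintro ⟨I, hI, h⟩
      -- A word encodes at most one instance, so the equilibrium found is one of the constructed
      -- game.
      obtain rfl := Instance2.encode_injective hI
      exact h
  · intro ρ
    rw [g.target_one]
    exact huniv ρ
  · intro ρ hρ
    exact hiff (fun x a => M.game_trans_mem_target eP eA c₀ k₀ k₁ letter yes w hN x a) hρ

end Doomsday

theorem mainTheorem9 :
    Doomsday.PTimeHard Doomsday.buchiDoomsdayProblem ∧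
      Doomsday.PTimeHard Doomsday.coBuchiDoomsdayProblem :=
  ⟨Doomsday.pTimeHard_of_forall_iff Doomsday.mem_buchi_univ Doomsday.mem_buchi_iff,
    Doomsday.pTimeHard_of_forall_iff Doomsday.mem_coBuchi_univ Doomsday.mem_coBuchi_iff⟩
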